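/- Let $K$ be a quadratic extension of $\mathbb Q$ with ring of integers $\mathbb Z_K$ and unit group $U_K=\mathbb Z_K^\times$. For a finite place $v$ of $K$ let $\mathcal U_v$ be the unit group and $\mathcal M_v$ the maximal ideal of the ring of integers of the completion $K_v$. Let $\mathfrak a$ be a nonzero ideal of $\mathbb Z_K$ and let $\xi$ be a character of $(\mathbb Z_K/\mathfrak a)^\times$ of order $2^e$ with $e\ge 1$ that is primitive, i.e. does not factor through $(\mathbb Z_K/\mathfrak b)^\times$ for any ideal $\mathfrak b\supsetneq\mathfrak a$ of $\mathbb Z_K$. Suppose that one of the following holds, where $\xi(u)$ denotes $\xi(u \bmod \mathfrak a)$ for $u\in U_K$: (a) $K$ is imaginary with odd class number, and $\xi(U_K)=1$; (b) $K=\mathbb Q(\sqrt d)$ for $d=2$ or a prime $d\equiv 1 \pmod 4$, and $\xi(U_K)\subseteq\{\pm1\}$. Then there is a unique idele class character $\chi$ of $K$ (a continuous homomorphism from the idele group $I_K$ to the unit circle, trivial on $K^\times$) of conductor $\mathfrak a$ and order $2^e$ whose restriction to $\prod_{v\ \mathrm{finite}}\mathcal U_v$ lifts $\xi$. Here the conductor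 is $\prod_v v^{n(\chi_v)}$ over the finite places $v$, with $n(\chi_v)=0$ if $\chi$ is trivial on $\mathcal U_v$ and otherwise $n(\chi_v)$ the least $n\ge1$ such that $\chi$ is trivial on $1+\mathcal M_v^n$; and $\chi$ lifts $\xi$ if on $\prod_v\mathcal U_v$ it is the composite of $\xi$ with the natural map $\prod_v \mathcal U_v\to\prod_{v\mid\mathfrak a}\mathcal U_v/(1+\mathcal M_v^{\mathrm{ord}_v\mathfrak a})\cong(\mathbb Z_K/\mathfrak a)^\times$. -/

import Mathlib

open NumberField IsDedekindDomain

noncomputable section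

namespace QuadraticIdele

/-- The group of ideles of `K`: the units of the adele ring, with the unit topology
(the topology of the restricted product of the groups `K_v^×`). -/
abbrev Ideles (K : Type*) [Field K] [NumberField K] : Type _ :=
  (AdeleRing (𝓞 K) K)ˣ

/-- The component of an idele at the infinite places. -/
def infPart {K : Type*} [Field K] [NumberField K] (x : Ideles K) : InfiniteAdeleRing K :=
  (x : AdeleRing (𝓞 K) K).1

/-- The component `x_v` of an idele `x` at a finite place `v`. -/
def finComp {K : Type*} [Field K] [NumberField K] (x : Ideles K)
    (v : HeightOneSpectrum (𝓞 K)) : v.adicCompletion K :=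
  (x : AdeleRing (𝓞 K) K).2 v

/-- A character of `I_K`: a continuous homomorphism to the unit circle. -/
abbrev IdeleCharacter (K : Type*) [Field K] [NumberField K] : Type _ :=
  Ideles K →ₜ* Circle

/-- A character of the ideles is an idele class character if it is trivial on the
diagonally embedded group `K^×`. -/
def IsIdeleClassCharacter {K : Type*} [Field K] [NumberField K]
    (χ : IdeleCharacter K) : Prop :=
  ∀ a : Kˣ, χ (Units.map (algebraMap K (AdeleRing (𝓞 K) K)).toMonoidHom a) = 1

/-- The ideles supported at the finite place `v` whose component at `v` lies in the unit group
`U_v` if `n = 0`, and in `1 + M_v ^ n` if `n ≥ 1`. (For `n ≥ 1` the first condition on `x_v`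
follows from the second; for `n = 0` the second follows from the first.) -/
def localUnits {K : Type*} [Field K] [NumberField K]
    (v : HeightOneSpectrum (𝓞 K)) (n : ℕ) : Set (Ideles K) :=
  {x | infPart x = 1 ∧ (∀ w, w ≠ v → finComp x w = 1) ∧
    Valued.v (finComp x v) = 1 ∧ Valued.v (finComp x v - 1) ≤ WithZero.exp (-(n : ℤ))}

/-- The exponent of the conductor of `χ_v`: it is `0` if `χ_v` is trivial on `U_v`, and otherwise
the smallest `n ≥ 1` such that `χ_v` is trivial on `1 + M_v ^ n`. -/
def conductorExponent {K : Type*} [Field K] [NumberField K]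
    (χ : IdeleCharacter K) (v : HeightOneSpectrum (𝓞 K)) : ℕ :=
  sInf {n : ℕ | ∀ x ∈ localUnits v n, χ x = 1}

/-- The conductor of `χ`, the product of the `v ^ n(χ_v)` over the (finitely many) finite places
where `χ` is ramified. -/
def conductor {K : Type*} [Field K] [NumberField K] (χ : IdeleCharacter K) : Ideal (𝓞 K) :=
  ∏ᶠ v : HeightOneSpectrum (𝓞 K), v.asIdeal ^ conductorExponent χ v

/-- The ideles with trivial infinite component and all finite components units, i.e. the
unit group `∏ U_v` of the finite ideles. -/
def finiteUnitIdeles (K : Type*) [Field K] [NumberField K] : Set (Ideles K) :=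
  {x | infPart x = 1 ∧ ∀ v, Valued.v (finComp x v) = 1}

/-- `x ≡ r` modulo `𝔞`: for every prime power `v ^ n` dividing `𝔞` one has
`x_v ≡ r` modulo `M_v ^ n`. -/
def CongrMod {K : Type*} [Field K] [NumberField K] (𝔞 : Ideal (𝓞 K))
    (x : Ideles K) (r : 𝓞 K) : Prop :=
  ∀ (v : HeightOneSpectrum (𝓞 K)) (n : ℕ), v.asIdeal ^ n ∣ 𝔞 →
    Valued.v (finComp x v - ((r : K) : v.adicCompletion K)) ≤ WithZero.exp (-(n : ℤ))

/-- `χ` restricted to `∏ U_v` lifts the character `ξ` of `(𝓞 K / 𝔞)^×`: it is the composite of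
`ξ` with `∏ U_v → ∏_{v ∣ 𝔞} U_v / (1 + M_v ^ ord_v 𝔞) ≅ (𝓞 K / 𝔞)^×`, the map which sends `x` to
the class of any `r` with `x ≡ r` modulo `𝔞`. -/
def Lifts {K : Type*} [Field K] [NumberField K] {𝔞 : Ideal (𝓞 K)}
    (χ : IdeleCharacter K) (ξ : (𝓞 K ⧸ 𝔞)ˣ →* Circle) : Prop :=
  ∀ x ∈ finiteUnitIdeles K, ∀ (r : 𝓞 K) (a : (𝓞 K ⧸ 𝔞)ˣ),
    (a : 𝓞 K ⧸ 𝔞) = Ideal.Quotient.mk 𝔞 r → CongrMod 𝔞 x r → χ x = ξ a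

/-- A character of `(R / 𝔞)^×` is primitive if it does not factor through `(R / 𝔟)^×` for any
ideal `𝔟` properly containing `𝔞`. -/
def IsPrimitive {R : Type*} [CommRing R] {𝔞 : Ideal R} (ξ : (R ⧸ 𝔞)ˣ →* Circle) : Prop :=
  ∀ (𝔟 : Ideal R) (h : 𝔞 < 𝔟),
    ¬ ∃ η : (R ⧸ 𝔟)ˣ →* Circle, ξ = η.comp (Units.map (Ideal.Quotient.factor h.le).toMonoidHom)

/-- The value of `ξ` on a global unit `u`, as a complex number. -/
def unitValue {R : Type*} [CommRing R] {𝔞 : Ideal R} (ξ : (R ⧸ 𝔞)ˣ →* Circle) (u : Rˣ) : ℂ :=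
  (ξ (Units.map (Ideal.Quotient.mk 𝔞).toMonoidHom u) : ℂ)

end QuadraticIdele

end

noncomputable section

/-! Let h be the class number, odd in both cases, and choose m with h m ≡ 1 modulo 2^e. For every
idele x, the power x^(h m) is a principal idele times a unit idele, and a character killed by 2^e
takes the same value at x and at x^(h m). So a class character of order 2^e is determined by its
restriction θ to the unit ideles. Conversely any θ killed by 2^e and trivial on global units extends
(`exists_monoidHom_of_pow_eq`, `exists_character`).

On the unit ideles θ is ξ of the reduction modulo 𝔞, times a character ψ of the infinite component.
Triviality on U_K means ψ = ξ⁻¹ there. A ψ that is also trivial on squares exists once global units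
and squares together fill the infinite component and ξ kills each unit that is a square at infinity.
Uniqueness (`character_unique`) needs the first condition with 2^e-th powers. Primitivity of ξ makes
the conductor exactly 𝔞.

In case (a) the infinite component is ℂ^×, where every element is an n-th power. In case (b) one
needs h odd, units of every signature, and totally positive units to be squares. All three come from
genus theory for a single ramified prime: ideals invariant under conjugation are principal
(`exists_generator_of_map_eq`), whence Hilbert 90 yields a unit of norm −1
(`exists_unit_norm_eq_neg_one`) and the absence of ideal classes of order 2 (`odd_classNumber`). -/

namespace QuadraticIdele

/-! ### Conjugation on the ring of integers of ℚ(√d). -/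

section

/-- The data of the ring of integers of the quadratic field `ℚ(√d)`, `d` prime and not congruent
to `3` modulo `4`: a square root of `d` and the nontrivial automorphism, together with the fact
that a prime modulo which this automorphism is trivial contains `√d`. -/
structure PrimeQuadratic (K : Type*) [Field K] [NumberField K] where
  d : ℕ
  prime : d.Prime
  s : 𝓞 K
  sq : s ^ 2 = d
  τ : K ≃ₐ[ℚ] K
  σ : 𝓞 K ≃+* 𝓞 K
  coe_σ : ∀ x : 𝓞 K, (σ x : K) = τ x
  invol : ∀ x, σ (σ x) = x
  fixed : ∀ x, σ x = x → ∃ n : ℤ, x = n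
  map_s : σ s = -s
  mem_of_sub_mem : ∀ P : Ideal (𝓞 K), P.IsPrime → (∀ x, σ x - x ∈ P) → s ∈ P
  finrank : Module.finrank ℚ K = 2

namespace PrimeQuadratic

variable {K : Type*} [Field K] [NumberField K]

theorem exists_conj (hK : Module.finrank ℚ K = 2) {d : ℕ} (hd : d.Prime) {s : K}
    (hs : s ^ 2 = (d : K)) :
    ∃ τ : K ≃ₐ[ℚ] K, τ s = -s ∧ (∀ x, τ (τ x) = x) ∧ ∀ x, τ x = x → ∃ q : ℚ, x = q := by
  have : Algebra.IsQuadraticExtension ℚ K := ⟨hK⟩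
  have hcard : Nat.card (K ≃ₐ[ℚ] K) = 2 := by rw [IsGalois.card_aut_eq_finrank, hK]
  have hnt : Nontrivial (K ≃ₐ[ℚ] K) := (Finite.one_lt_card_iff_nontrivial).1 (by omega)
  obtain ⟨τ, hτ⟩ := exists_ne (1 : K ≃ₐ[ℚ] K)
  have hsurj : ∀ g : K ≃ₐ[ℚ] K, g ∈ Subgroup.zpowers τ := fun g =>
    mem_zpowers_of_prime_card (p := 2) (by simpa using hcard) hτ
  have hfix : ∀ x, τ x = x → ∃ q : ℚ, x = q := by
    intro x hx
    have h1 : x ∈ (⊥ : IntermediateField ℚ K) := by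
      rw [IsGalois.mem_bot_iff_fixed]
      intro f
      have : Subgroup.zpowers τ ≤ MulAction.stabilizer (K ≃ₐ[ℚ] K) x := by
        rw [Subgroup.zpowers_le]; exact hx
      exact this (hsurj f)
    obtain ⟨q, hq⟩ := IntermediateField.mem_bot.1 h1
    exact ⟨q, by simp [← hq]⟩
  have h2 : τ ^ 2 = 1 := by rw [← hcard]; exact pow_card_eq_one'
  refine ⟨τ, ?_, fun x => by simpa [sq] using DFunLike.congr_fun h2 x, hfix⟩
  have h3 : (τ s) ^ 2 = s ^ 2 := by rw [← map_pow, hs]; simp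
  rcases sq_eq_sq_iff_eq_or_eq_neg.1 h3 with h | h
  · exfalso
    obtain ⟨q, rfl⟩ := hfix s h
    have : q ^ 2 = (d : ℚ) := by exact_mod_cast hs
    have hirr := hd.irrational_sqrt
    apply hirr
    refine ⟨|q|, ?_⟩
    have : (q : ℝ) ^ 2 = d := by exact_mod_cast this
    rw [← this, Real.sqrt_sq_eq_abs]; simp
  · exact h

theorem nonempty (hK : Module.finrank ℚ K = 2) {d : ℕ} (hd : d.Prime) (hd4 : d % 4 = 1 ∨ d = 2)
    {s : K} (hs : s ^ 2 = (d : K)) : Nonempty (PrimeQuadratic K) := by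
  obtain ⟨τ, hτs, hττ, hfix⟩ := exists_conj hK hd hs
  have hint : IsIntegral ℤ s := by
    apply IsIntegral.of_pow (n := 2) (by norm_num)
    rw [hs]; exact_mod_cast isIntegral_algebraMap (R := ℤ) (A := K) (x := (d : ℤ))
  obtain ⟨s', hs'⟩ : ∃ s' : 𝓞 K, (s' : K) = s := ⟨⟨s, hint⟩, rfl⟩
  refine ⟨⟨d, hd, s', ?_, τ, RingOfIntegers.mapRingEquiv τ, fun x => rfl, ?_, ?_, ?_, ?_, hK⟩⟩
  · apply RingOfIntegers.ext; simpa [hs'] using hs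
  · intro x; apply RingOfIntegers.ext; simp [hττ]
  · intro x hx
    obtain ⟨q, hq⟩ := hfix x (by simpa using congrArg (fun y : 𝓞 K => (y : K)) hx)
    have hqi : IsIntegral ℤ q := by
      have : IsIntegral ℤ (x : K) := x.isIntegral_coe
      rw [show (x : K) = q from hq] at this
      exact (isIntegral_algebraMap_iff (algebraMap ℚ K).injective).1 (by simpa using this)
    obtain ⟨n, hn⟩ := IsIntegrallyClosed.isIntegral_iff.1 hqi
    refine ⟨n, RingOfIntegers.ext ?_⟩
    rw [hq, ← hn]; simp
  · apply RingOfIntegers.ext; simp [hs', hτs]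
  · intro P hP h
    -- For d ≡ 1 modulo 4 the test element is (1 + s) / 2, which conjugation moves by −s; for d = 2
    -- it is s itself, moved by −2s = −s³.
    rcases hd4 with h4 | rfl
    · have h2 : (2 : K) ≠ 0 := two_ne_zero
      have hω : IsIntegral ℤ ((1 + s) / 2) := by
        refine ⟨Polynomial.X ^ 2 - Polynomial.X - Polynomial.C ((d / 4 : ℕ) : ℤ), ?_, ?_⟩
        · monicity!
        · have hd' : (d : K) = 4 * ((d / 4 : ℕ) : K) + 1 := by
            have : d = 4 * (d / 4) + 1 := by omega
            exact_mod_cast this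
          simp only [Polynomial.eval₂_sub, Polynomial.eval₂_pow, Polynomial.eval₂_X,
            Polynomial.eval₂_C]
          rw [hd'] at hs
          simp only [eq_intCast, Int.cast_natCast]
          field_simp
          linear_combination hs
      obtain ⟨ω, hω'⟩ : ∃ ω : 𝓞 K, (ω : K) = (1 + s) / 2 := ⟨⟨_, hω⟩, rfl⟩
      have := h ω
      have heq : RingOfIntegers.mapRingEquiv τ.toRingEquiv ω - ω = - s' := by
        apply RingOfIntegers.ext
        have h2' : τ 2 = 2 := map_ofNat τ 2
        simp [hω', hs', hτs, h2']
        ring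
      rw [heq] at this
      simpa using this
    · have := h s'
      have heq : RingOfIntegers.mapRingEquiv τ s' - s' = - (s' * s' * s') := by
        apply RingOfIntegers.ext
        simp [hs', hτs]
        linear_combination s * hs
      rw [heq, neg_mem_iff] at this
      rcases hP.mem_or_mem this with h | h
      · rcases hP.mem_or_mem h with h | h <;> exact h
      · exact h

end PrimeQuadratic

end

/-! ### Prime ideals and conjugation-invariant ideals. -/

section
namespace PrimeQuadratic

variable {K : Type*} [Field K] [NumberField K] (D : PrimeQuadratic K)

theorem s_ne_zero : D.s ≠ 0 := by
  intro h
  have := D.sq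
  rw [h] at this
  have h2 : (D.d : 𝓞 K) ≠ 0 := Nat.cast_ne_zero.2 D.prime.ne_zero
  exact h2 (by rw [← this]; simp)

theorem absNorm_span_nat {K : Type*} [Field K] [NumberField K] (D : PrimeQuadratic K) (n : ℕ) :
    (Ideal.span {(n : 𝓞 K)}).absNorm = n ^ 2 := by
  rw [Ideal.absNorm_span_natCast, RingOfIntegers.rank, D.finrank]

theorem absNorm_span_s : (Ideal.span {D.s}).absNorm = D.d := by
  have h : (Ideal.span {D.s} ^ 2).absNorm = D.d ^ 2 := by
    rw [Ideal.span_singleton_pow, D.sq, D.absNorm_span_nat]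
  rw [map_pow] at h
  exact Nat.pow_left_injective (n := 2) (by norm_num) h

theorem map_span_singleton (x : 𝓞 K) : (Ideal.span {x}).map D.σ = Ideal.span {D.σ x} := by
  rw [Ideal.map_span, Set.image_singleton]

theorem map_eq_bot_iff (I : Ideal (𝓞 K)) : I.map D.σ = ⊥ ↔ I = ⊥ :=
  Ideal.map_eq_bot_iff_of_injective D.σ.injective

theorem exists_nat_prime_mem (P : Ideal (𝓞 K)) [hP : P.IsPrime] (h0 : P ≠ ⊥) :
    ∃ q : ℕ, q.Prime ∧ (q : 𝓞 K) ∈ P := by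
  have key : ∀ n : ℕ, n ≠ 0 → (n : 𝓞 K) ∈ P → ∃ q : ℕ, q.Prime ∧ (q : 𝓞 K) ∈ P := by
    intro n
    induction n using Nat.recOnMul with
    | zero => intro h; exact absurd rfl h
    | one => intro _ h; exact absurd ((Ideal.eq_top_iff_one P).2 (by simpa using h)) hP.ne_top
    | prime p hp => intro _ h; exact ⟨p, hp, h⟩
    | mul a b iha ihb =>
      intro hn h
      rw [Nat.cast_mul] at h
      rcases hP.mem_or_mem h with h | h
      · exact iha (left_ne_zero_of_mul hn) h
      · exact ihb (right_ne_zero_of_mul hn) h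
  exact key P.absNorm (by simpa [Ideal.absNorm_eq_zero_iff] using h0) P.absNorm_mem

theorem eq_of_dvd_of_absNorm_eq {I J : Ideal (𝓞 K)} (hJ : J ≠ ⊥) (h : I ∣ J)
    (hN : I.absNorm = J.absNorm) : I = J := by
  obtain ⟨C, rfl⟩ := h
  rw [map_mul] at hN
  have hI : I.absNorm ≠ 0 := by
    rw [Ne, Ideal.absNorm_eq_zero_iff]; rintro rfl; simp at hJ
  have : C.absNorm = 1 := by
    have : I.absNorm * 1 = I.absNorm * C.absNorm := by rw [mul_one]; exact hN
    exact (Nat.eq_of_mul_eq_mul_left (Nat.pos_of_ne_zero hI) this).symm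
  rw [Ideal.absNorm_eq_one_iff] at this
  rw [this, Ideal.mul_top]

/-- The residue field of a prime of norm a rational prime is generated by integers. -/
theorem exists_int_sub_mem (P : Ideal (𝓞 K)) {q : ℕ} (hq : q.Prime) (hN : P.absNorm = q)
    (x : 𝓞 K) : ∃ n : ℤ, x - n ∈ P := by
  have hcard : Nat.card (𝓞 K ⧸ P) = q := by
    rw [← hN]; rfl
  have hfact := Fact.mk hq
  have hne : (1 : 𝓞 K ⧸ P) ≠ 0 := by
    intro h
    have hsub := subsingleton_of_zero_eq_one h.symm
    have : Nat.card (𝓞 K ⧸ P) = 1 := Nat.card_unique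
    exact hq.one_lt.ne' (hcard.symm.trans this)
  have := mem_zmultiples_of_prime_card (p := q) hcard hne (g' := Ideal.Quotient.mk P x)
  obtain ⟨n, hn⟩ := AddSubgroup.mem_zmultiples_iff.1 this
  refine ⟨n, ?_⟩
  rw [← Ideal.Quotient.eq, ← hn]
  simp

/-- The split, inert and ramified cases. If P is invariant of norm a rational prime q, its residue
field is generated by integers, so conjugation acts trivially on it and `mem_of_sub_mem` gives √d ∈
P. As (√d) has prime norm d, comparing norms gives P = (√d), the only ramified prime. -/
theorem prime_cases (P : Ideal (𝓞 K)) [hP : P.IsPrime] (h0 : P ≠ ⊥) :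
    (∃ n : ℕ, n ≠ 0 ∧ P.map D.σ ≠ P ∧ P * P.map D.σ = Ideal.span {(n : 𝓞 K)}) ∨
    (∃ n : ℕ, n ≠ 0 ∧ P = Ideal.span {(n : 𝓞 K)}) ∨ P = Ideal.span {D.s} := by
  obtain ⟨q, hq, hqP⟩ := exists_nat_prime_mem P h0
  have hq0 : Ideal.span {(q : 𝓞 K)} ≠ ⊥ := by
    rw [Ne, Ideal.span_singleton_eq_bot]; exact Nat.cast_ne_zero.2 hq.ne_zero
  have hdvd : ∀ Q : Ideal (𝓞 K), Q.IsPrime → (q : 𝓞 K) ∈ Q → q ∣ Q.absNorm := by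
    intro Q hQ h
    have h1 : Q.absNorm ∣ q ^ 2 := by
      rw [← D.absNorm_span_nat q]
      exact Ideal.absNorm_dvd_absNorm_of_le ((Ideal.span_singleton_le_iff_mem _).2 h)
    obtain ⟨k, -, hk⟩ := (Nat.dvd_prime_pow hq).1 h1
    rw [hk]
    apply dvd_pow_self
    rintro rfl
    exact hQ.ne_top (Ideal.absNorm_eq_one_iff.1 (by simpa using hk))
  have hPq : P ∣ Ideal.span {(q : 𝓞 K)} :=
    Ideal.dvd_iff_le.2 ((Ideal.span_singleton_le_iff_mem _).2 hqP)
  have hσP : (P.map D.σ).IsPrime := Ideal.map_isPrime_of_equiv D.σ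
  by_cases hs : P.map D.σ = P
  · right
    have h1 : P.absNorm ∣ q ^ 2 := by
      rw [← D.absNorm_span_nat q]
      exact Ideal.absNorm_dvd_absNorm_of_le ((Ideal.span_singleton_le_iff_mem _).2 hqP)
    obtain ⟨k, hk2, hk⟩ := (Nat.dvd_prime_pow hq).1 h1
    interval_cases k
    · exact absurd (Ideal.absNorm_eq_one_iff.1 (by simpa using hk)) hP.ne_top
    · right
      rw [pow_one] at hk
      have hsP : D.s ∈ P := by
        apply D.mem_of_sub_mem P hP
        intro x
        obtain ⟨n, hn⟩ := exists_int_sub_mem P hq hk x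
        have h2 : D.σ (x - n) ∈ P := by
          have := Ideal.mem_map_of_mem D.σ hn
          rwa [hs] at this
        have : D.σ x - x = D.σ (x - n) - (x - n) := by simp
        rw [this]
        exact sub_mem h2 hn
      have hle : Ideal.span {D.s} ≤ P := (Ideal.span_singleton_le_iff_mem _).2 hsP
      have hd := Ideal.absNorm_dvd_absNorm_of_le hle
      rw [D.absNorm_span_s, hk] at hd
      have hqd := (Nat.prime_dvd_prime_iff_eq hq D.prime).1 hd
      apply eq_of_dvd_of_absNorm_eq
      · rw [Ne, Ideal.span_singleton_eq_bot]; exact D.s_ne_zero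
      · exact Ideal.dvd_iff_le.2 hle
      · rw [D.absNorm_span_s, hk, hqd]
    · left
      exact ⟨q, hq.ne_zero, eq_of_dvd_of_absNorm_eq hq0 hPq (by rw [hk, D.absNorm_span_nat])⟩
  · left
    refine ⟨q, hq.ne_zero, hs, ?_⟩
    have hqσ : (q : 𝓞 K) ∈ P.map D.σ := by simpa using Ideal.mem_map_of_mem D.σ hqP
    have hcop : IsCoprime P (P.map D.σ) := by
      rw [Ideal.isCoprime_iff_sup_eq]
      have hPm := hP.isMaximal h0
      have hσm := hσP.isMaximal (by rwa [Ne, D.map_eq_bot_iff])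
      exact hPm.coprime_of_ne hσm (Ne.symm hs)
    have hmul : P * P.map D.σ ∣ Ideal.span {(q : 𝓞 K)} :=
      hcop.mul_dvd hPq (Ideal.dvd_iff_le.2 ((Ideal.span_singleton_le_iff_mem _).2 hqσ))
    apply eq_of_dvd_of_absNorm_eq hq0 hmul
    apply Nat.dvd_antisymm
    · exact map_dvd _ hmul
    · rw [D.absNorm_span_nat, map_mul, pow_two]
      exact mul_dvd_mul (hdvd P hP hqP) (hdvd _ hσP hqσ)

/-- Conjugation thus inverts ideal classes. The property is multiplicative, so it suffices to check
the three kinds of primes. -/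
theorem mul_map_eq_span_nat (I : Ideal (𝓞 K)) (hI : I ≠ ⊥) :
    ∃ n : ℕ, n ≠ 0 ∧ I * I.map D.σ = Ideal.span {(n : 𝓞 K)} := by
  induction I using UniqueFactorizationMonoid.induction_on_prime with
  | h₁ => exact absurd rfl hI
  | h₂ x hx =>
    have : x = ⊤ := by simpa using hx
    exact ⟨1, one_ne_zero, by simp [this, Ideal.map_top]⟩
  | h₃ J P hJ hP ih =>
    obtain ⟨n, hn, h⟩ := ih hJ
    have hP0 : P ≠ ⊥ := hP.ne_zero
    have hPp : P.IsPrime := Ideal.isPrime_of_prime hP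
    have : ∃ m : ℕ, m ≠ 0 ∧ P * P.map D.σ = Ideal.span {(m : 𝓞 K)} := by
      rcases D.prime_cases P hP0 with ⟨m, hm, -, h⟩ | ⟨m, hm, h⟩ | h
      · exact ⟨m, hm, h⟩
      · refine ⟨m ^ 2, pow_ne_zero 2 hm, ?_⟩
        rw [h, D.map_span_singleton, Ideal.span_singleton_mul_span_singleton]
        simp [pow_two]
      · refine ⟨D.d, D.prime.ne_zero, ?_⟩
        rw [h, D.map_span_singleton, Ideal.span_singleton_mul_span_singleton, D.map_s, ← D.sq,
          mul_neg, Ideal.span_singleton_neg, pow_two]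
    obtain ⟨m, hm, hm'⟩ := this
    refine ⟨m * n, mul_ne_zero hm hn, ?_⟩
    rw [Ideal.map_mul, mul_mul_mul_comm, hm', h, Ideal.span_singleton_mul_span_singleton]
    simp

/-- An ideal invariant under conjugation is generated by a product of an integer and a power
of `√d`. -/
theorem exists_generator_of_map_eq (J : Ideal (𝓞 K)) (hJ : J ≠ ⊥) (hσ : J.map D.σ = J) :
    ∃ g : 𝓞 K, J = Ideal.span {g} ∧ (D.σ g = g ∨ D.σ g = -g) := by
  induction hn : J.absNorm using Nat.strong_induction_on generalizing J with
  | _ n ih =>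
  -- A proper divisor (c) with σ c = ±c can be split off: the cofactor is again invariant and of
  -- smaller norm. Below, c is an integer (the generator of P · σP, or of an inert P) or √d.
  have step : ∀ c : 𝓞 K, (D.σ c = c ∨ D.σ c = -c) → Ideal.span {c} ≠ ⊤ →
      Ideal.span {c} ∣ J → ∃ g : 𝓞 K, J = Ideal.span {g} ∧ (D.σ g = g ∨ D.σ g = -g) := by
    rintro c hc hc1 ⟨C, rfl⟩
    have hc0 : Ideal.span {c} ≠ ⊥ := fun h => hJ (by rw [h, Ideal.bot_mul])
    have hC0 : C ≠ ⊥ := fun h => hJ (by rw [h, Ideal.mul_bot])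
    have hcm : (Ideal.span {c}).map D.σ = Ideal.span {c} := by
      rw [D.map_span_singleton]
      rcases hc with h | h <;> rw [h]
      rw [Ideal.span_singleton_neg]
    rw [Ideal.map_mul, hcm] at hσ
    have hC := mul_left_cancel₀ hc0 hσ
    have hlt : C.absNorm < n := by
      rw [← hn, map_mul]
      apply lt_mul_left
      · exact Nat.pos_of_ne_zero (by rwa [Ne, Ideal.absNorm_eq_zero_iff])
      · have h0 : (Ideal.span {c}).absNorm ≠ 0 := by rwa [Ne, Ideal.absNorm_eq_zero_iff]
        have h1 : (Ideal.span {c}).absNorm ≠ 1 := by rwa [Ne, Ideal.absNorm_eq_one_iff]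
        omega
    obtain ⟨g, hg, hg'⟩ := ih _ hlt C hC0 hC rfl
    refine ⟨c * g, by rw [hg, Ideal.span_singleton_mul_span_singleton], ?_⟩
    rw [map_mul]
    rcases hc with h | h <;> rcases hg' with h' | h' <;> rw [h, h'] <;> simp
  by_cases hJ1 : J = ⊤
  · exact ⟨1, by simp [hJ1], by simp⟩
  obtain ⟨P, hPm, hPJ⟩ := Ideal.exists_le_maximal J hJ1
  have hPp := hPm.isPrime
  have hP0 : P ≠ ⊥ := ne_bot_of_le_ne_bot hJ hPJ
  have hPd : P ∣ J := Ideal.dvd_iff_le.2 hPJ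
  rcases D.prime_cases P hP0 with ⟨m, hm, hne, h⟩ | ⟨m, hm, h⟩ | h
  · apply step m (by simp)
    · rw [← h]
      exact fun h => hPm.ne_top (top_le_iff.1 (h ▸ Ideal.mul_le_left))
    · rw [← h]
      have hσm : (P.map D.σ).IsPrime := Ideal.map_isPrime_of_equiv D.σ
      have hcop : IsCoprime P (P.map D.σ) := by
        rw [Ideal.isCoprime_iff_sup_eq]
        exact hPm.coprime_of_ne (hσm.isMaximal (by rwa [Ne, D.map_eq_bot_iff])) (Ne.symm hne)
      refine hcop.mul_dvd hPd (Ideal.dvd_iff_le.2 ?_)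
      rw [← hσ]
      exact Ideal.map_mono hPJ
  · rw [h] at hPd hPm
    exact step m (by simp) hPm.ne_top hPd
  · rw [h] at hPd hPm
    exact step D.s (by simp [D.map_s]) hPm.ne_top hPd

end PrimeQuadratic

end

/-! ### Units, the unit of norm −1, and the parity of the class number. -/

section
namespace PrimeQuadratic

variable {K : Type*} [Field K] [NumberField K] (D : PrimeQuadratic K)

/-- Here a and b are the traces of x and of s x. This replaces an integral basis in showing that
every embedding is real because √d is. -/
theorem exists_two_mul_s_mul (x : 𝓞 K) : ∃ a b : ℤ, 2 * D.s * x = a * D.s + b := by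
  obtain ⟨a, ha⟩ := D.fixed (x + D.σ x) (by rw [map_add, D.invol, add_comm])
  obtain ⟨b, hb⟩ := D.fixed ((x - D.σ x) * D.s) (by
    rw [map_mul, map_sub, D.invol, D.map_s]; ring)
  exact ⟨a, b, by rw [← ha, ← hb]; ring⟩

theorem isReal_embedding (D : PrimeQuadratic K) (φ : K →+* ℂ) : ComplexEmbedding.IsReal φ := by
  have hs : (starRingEnd ℂ) (φ D.s) = φ D.s := by
    have h1 : (φ D.s) ^ 2 = (D.d : ℂ) := by
      rw [← map_pow]
      have : (D.s : K) ^ 2 = (D.d : K) := by exact_mod_cast congrArg (fun y : 𝓞 K => (y : K)) D.sq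
      rw [this]; simp
    have h2 : ((Real.sqrt D.d : ℝ) : ℂ) ^ 2 = (D.d : ℂ) := by
      rw [← Complex.ofReal_pow, Real.sq_sqrt (Nat.cast_nonneg _)]; simp
    rcases sq_eq_sq_iff_eq_or_eq_neg.1 (h1.trans h2.symm) with h | h <;> rw [h] <;> simp
  have hs0 : φ D.s ≠ 0 := by
    rw [Ne, map_eq_zero, RingOfIntegers.coe_eq_zero_iff]; exact D.s_ne_zero
  have hx : ∀ x : 𝓞 K, (starRingEnd ℂ) (φ x) = φ x := by
    intro x
    obtain ⟨a, b, h⟩ := D.exists_two_mul_s_mul x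
    have h' : 2 * φ D.s * φ x = a * φ D.s + b := by
      have := congrArg (fun y : 𝓞 K => φ (y : K)) h
      simpa only [map_mul, map_add, map_intCast, map_ofNat] using this
    have h'' : 2 * φ D.s * (starRingEnd ℂ) (φ x) = a * φ D.s + b := by
      have := congrArg (starRingEnd ℂ) h'
      simpa only [map_mul, map_add, map_intCast, map_ofNat, hs] using this
    exact mul_left_cancel₀ (mul_ne_zero two_ne_zero hs0) (h''.trans h'.symm)
  rw [ComplexEmbedding.isReal_iff]
  ext x
  obtain ⟨a, b, -, rfl⟩ := IsFractionRing.div_surjective (A := 𝓞 K) x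
  rw [ComplexEmbedding.conjugate_coe_eq, map_div₀, map_div₀, hx, hx]

theorem isTotallyReal (D : PrimeQuadratic K) : IsTotallyReal K where
  isReal _ := InfinitePlace.isReal_iff.2 (D.isReal_embedding _)

theorem card_infinitePlace (D : PrimeQuadratic K) : Fintype.card (InfinitePlace K) = 2 := by
  have := D.isTotallyReal
  have h := IsTotallyReal.finrank (K := K)
  rw [D.finrank] at h
  rw [InfinitePlace.card_eq_nrRealPlaces_add_nrComplexPlaces, ← h]
  simp

theorem torsion_cases (D : PrimeQuadratic K) (ζ : (𝓞 K)ˣ) (hζ : ζ ∈ Units.torsion K) :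
    ζ = 1 ∨ ζ = -1 := by
  have := D.isTotallyReal
  obtain ⟨v⟩ : Nonempty (InfinitePlace K) := inferInstance
  let φ := InfinitePlace.embedding_of_isReal (IsTotallyReal.isReal v)
  have h1 := (Units.mem_torsion K).1 hζ v
  rw [← InfinitePlace.norm_embedding_of_isReal (IsTotallyReal.isReal v), Real.norm_eq_abs] at h1
  rcases eq_or_eq_neg_of_abs_eq h1 with h | h
  · left
    ext
    apply φ.injective
    simpa using h
  · right
    ext
    apply φ.injective
    simpa using h

/-- The unit rank is 1 and the torsion is ±1. If ε were ± a square, uniqueness of its exponent would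
make 1 even. -/
theorem exists_fundamental_unit (D : PrimeQuadratic K) : ∃ ε : (𝓞 K)ˣ,
    (∀ u : (𝓞 K)ˣ, ∃ k : ℤ, u = ε ^ k ∨ u = -ε ^ k) ∧ ∀ w : (𝓞 K)ˣ, ε ≠ w ^ 2 ∧ ε ≠ -w ^ 2 := by
  have hrank : Units.rank K = 1 := by rw [Units.rank, D.card_infinitePlace]
  let i : Fin (Units.rank K) := ⟨0, by omega⟩
  have huniq : ∀ j, j = i := fun j => by
    have := j.2; apply Fin.ext; change j.1 = 0; omega
  have hp : ∀ f : Fin (Units.rank K) → ℤ,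
      ∏ j, Units.fundSystem K j ^ f j = Units.fundSystem K i ^ f i := fun f =>
    Fintype.prod_eq_single i fun j hj => absurd (huniq j) hj
  have hex : ∀ u : (𝓞 K)ˣ, ∃ (ζ : Units.torsion K) (k : ℤ), u = ζ * Units.fundSystem K i ^ k := by
    intro u
    obtain ⟨⟨ζ, f⟩, h, -⟩ := Units.exist_unique_eq_mul_prod K u
    exact ⟨ζ, f i, by simpa only [hp] using h⟩
  refine ⟨Units.fundSystem K i, fun u => ?_, fun w => ?_⟩
  · obtain ⟨ζ, k, h⟩ := hex u
    refine ⟨k, ?_⟩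
    rcases D.torsion_cases ζ.1 ζ.2 with h' | h' <;> rw [h'] at h <;> simp [h]
  · have key : ∀ ζ : Units.torsion K, Units.fundSystem K i ≠ ζ * w ^ 2 := by
      intro ζ h
      obtain ⟨ζ', k, hw⟩ := hex w
      have h1 : Units.fundSystem K i = (ζ * ζ' ^ 2 : Units.torsion K) *
          Units.fundSystem K i ^ (2 * k) := by
        nth_rewrite 1 [h]
        rw [hw]
        push_cast
        rw [mul_pow, zpow_mul', mul_assoc]
        norm_cast
      have h2 := (Units.exist_unique_eq_mul_prod K (Units.fundSystem K i)).unique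
        (y₁ := (ζ * ζ' ^ 2, fun _ => 2 * k)) (y₂ := (1, fun _ => 1)) (by simpa only [hp] using h1)
        (by simp only [hp]; simp)
      have h3 := congrFun (congrArg Prod.snd h2) i
      simp only at h3
      omega
    constructor
    · simpa using key 1
    · simpa using key ⟨-1, neg_one_mem_torsion⟩

theorem unit_norm_cases (u : (𝓞 K)ˣ) : (u : 𝓞 K) * D.σ u = 1 ∨ (u : 𝓞 K) * D.σ u = -1 := by
  obtain ⟨n, hn⟩ := D.fixed ((u : 𝓞 K) * D.σ u) (by rw [map_mul, D.invol, mul_comm])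
  have hu : IsUnit ((n : ℤ) : 𝓞 K) := by
    rw [← hn]; exact u.isUnit.mul (u.isUnit.map D.σ)
  obtain ⟨b, hb⟩ := hu.exists_right_inv
  have hb' : (n : 𝓞 K) * D.σ b = 1 := by
    have := congrArg D.σ hb
    simpa using this
  have hbb : b = D.σ b := hu.mul_left_cancel (hb.trans hb'.symm)
  obtain ⟨m, rfl⟩ := D.fixed b hbb.symm
  have : n * m = 1 := by exact_mod_cast hb
  rcases Int.eq_one_or_neg_one_of_mul_eq_one this with h | h <;> rw [hn, h] <;> simp

/-- Hilbert's theorem 90 for units, with the classification of the invariant ideals. -/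
theorem exists_sq_of_norm_eq_one (hall : ∀ w : (𝓞 K)ˣ, (w : 𝓞 K) * D.σ w = 1) (u : (𝓞 K)ˣ) :
    ∃ w : (𝓞 K)ˣ, u = w ^ 2 ∨ u = -w ^ 2 := by
  -- The Hilbert 90 element is b = 1 + u, with u σ(b) = b; it vanishes only for u = −1. Otherwise
  -- (b) is invariant, so b = g w with σ g = ±g and w a unit; then u σ(w) = ±w, and w σ(w) = 1 gives
  -- u = ±w².
  by_cases hb : (1 : 𝓞 K) + u = 0
  · refine ⟨1, Or.inr ?_⟩
    ext
    simp [eq_neg_of_add_eq_zero_right hb]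
  have hσ : (u : 𝓞 K) * D.σ (1 + u) = 1 + u := by
    rw [map_add, mul_add, hall, map_one]; ring
  have hinv : (Ideal.span {(1 : 𝓞 K) + u}).map D.σ = Ideal.span {(1 : 𝓞 K) + u} := by
    rw [D.map_span_singleton]
    nth_rewrite 2 [← hσ]
    rw [Ideal.span_singleton_mul_left_unit u.isUnit]
  obtain ⟨g, hg, hg'⟩ := D.exists_generator_of_map_eq _
    (by rwa [Ne, Ideal.span_singleton_eq_bot]) hinv
  obtain ⟨w, hw⟩ := Ideal.span_singleton_eq_span_singleton.1 hg.symm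
  have hg0 : g ≠ 0 := by rintro rfl; apply hb; rw [← hw]; simp
  refine ⟨w, ?_⟩
  have h1 : (u : 𝓞 K) * (D.σ g * D.σ w) = g * w := by rw [← map_mul, hw, hσ]
  rcases hg' with h | h
  · left
    apply Units.ext
    rw [h] at h1
    have h2 : (u : 𝓞 K) * D.σ w = w := by
      apply mul_left_cancel₀ hg0; linear_combination h1
    have h3 := hall w
    push_cast
    linear_combination (w : 𝓞 K) * h2 + (-(u : 𝓞 K)) * h3
  · right
    apply Units.ext
    rw [h] at h1
    have h2 : (u : 𝓞 K) * D.σ w = -w := by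
      apply mul_left_cancel₀ hg0; linear_combination -h1
    have h3 := hall w
    push_cast
    linear_combination (w : 𝓞 K) * h2 + (-(u : 𝓞 K)) * h3

/-- If all units had norm 1, the fundamental unit would be ± a square. -/
theorem exists_unit_norm_eq_neg_one : ∃ η : (𝓞 K)ˣ, (η : 𝓞 K) * D.σ η = -1 := by
  by_contra! h
  have hall : ∀ w : (𝓞 K)ˣ, (w : 𝓞 K) * D.σ w = 1 := fun w =>
    (D.unit_norm_cases w).resolve_right (h w)
  obtain ⟨ε, -, hε⟩ := D.exists_fundamental_unit
  obtain ⟨w, hw⟩ := D.exists_sq_of_norm_eq_one hall ε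
  rcases hw with hw | hw
  · exact (hε w).1 hw
  · exact (hε w).2 hw

/-- A class of order 2 would contain a conjugation-invariant ideal, and those are principal. With I²
= (γ) and I · σI = (n), the element γ / n has norm 1 after a sign correction, and Hilbert 90 turns
it into the factor making I invariant. -/
theorem odd_classNumber (D : PrimeQuadratic K) : Odd (classNumber K) := by
  by_contra hodd
  rw [Nat.not_odd_iff_even, even_iff_two_dvd] at hodd
  have := Fact.mk Nat.prime_two
  obtain ⟨c, hc⟩ := exists_prime_orderOf_dvd_card 2 hodd
  obtain ⟨⟨I, hI⟩, rfl⟩ := ClassGroup.mk0_surjective c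
  have hI0 : I ≠ ⊥ := nonZeroDivisors.ne_zero hI
  have hnp : ¬ I.IsPrincipal := by
    intro h
    rw [(ClassGroup.mk0_eq_one_iff hI).2 h] at hc
    simp at hc
  have h2 : (I ^ 2).IsPrincipal := by
    rw [← ClassGroup.mk0_eq_one_iff (pow_mem hI 2), ← pow_orderOf_eq_one (ClassGroup.mk0 ⟨I, hI⟩),
      hc, ← map_pow]
    rfl
  have hcl : ∀ c : 𝓞 K, c ≠ 0 → ∀ g : 𝓞 K, Ideal.span {c} * I = Ideal.span {g} → False := by
    intro c hc g hg
    apply hnp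
    have hgc : g ∈ Ideal.span {c} := by
      have : Ideal.span {g} ≤ Ideal.span {c} := hg ▸ Ideal.mul_le_left
      exact this (Ideal.mem_span_singleton_self g)
    obtain ⟨y, rfl⟩ := Ideal.mem_span_singleton.1 hgc
    rw [← Ideal.span_singleton_mul_span_singleton] at hg
    have hc0 : Ideal.span {c} ≠ ⊥ := by rwa [Ne, Ideal.span_singleton_eq_bot]
    exact ⟨⟨y, mul_left_cancel₀ hc0 hg⟩⟩
  obtain ⟨⟨γ₀, hγ₀⟩⟩ := h2
  change I ^ 2 = Ideal.span {γ₀} at hγ₀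
  obtain ⟨n, hn, hIσ⟩ := D.mul_map_eq_span_nat I hI0
  have hn0 : (n : 𝓞 K) ≠ 0 := Nat.cast_ne_zero.2 hn
  have hnorm : ∀ γ, I ^ 2 = Ideal.span {γ} →
      γ * D.σ γ = (n : 𝓞 K) ^ 2 ∨ γ * D.σ γ = -(n : 𝓞 K) ^ 2 := by
    intro γ hγ
    have h3 : Ideal.span {γ * D.σ γ} = Ideal.span {(n : 𝓞 K) ^ 2} := by
      rw [← Ideal.span_singleton_mul_span_singleton, ← D.map_span_singleton, ← hγ, Ideal.map_pow,
        ← mul_pow, hIσ, Ideal.span_singleton_pow]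
    obtain ⟨m, hm⟩ := D.fixed (γ * D.σ γ) (by rw [map_mul, D.invol, mul_comm])
    obtain ⟨u, hu⟩ := Ideal.span_singleton_eq_span_singleton.1 h3
    rw [hm] at hu ⊢
    have hu' : (m : 𝓞 K) * D.σ u = (n : 𝓞 K) ^ 2 := by
      have := congrArg D.σ hu; simpa using this
    have hm0 : (m : 𝓞 K) ≠ 0 := by
      intro h; rw [h, zero_mul] at hu; exact pow_ne_zero 2 hn0 hu.symm
    have huu : D.σ u = u := mul_left_cancel₀ hm0 (hu'.trans hu.symm)
    obtain ⟨k, hk⟩ := D.fixed u huu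
    have hk2 := D.unit_norm_cases u
    rw [huu, hk] at hk2
    have hk1 : k = 1 ∨ k = -1 := by
      rcases hk2 with h | h
      · exact mul_self_eq_one_iff.1 (by exact_mod_cast h)
      · have : k * k = -1 := by exact_mod_cast h
        nlinarith [mul_self_nonneg k]
    rcases hk1 with h | h
    · left; rw [← hu, hk, h]; simp
    · right; rw [← hu, hk, h]; simp
  -- The unit of norm −1 corrects the sign of the norm of the generator.
  obtain ⟨γ, hγ, hγn⟩ : ∃ γ, I ^ 2 = Ideal.span {γ} ∧ γ * D.σ γ = (n : 𝓞 K) ^ 2 := by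
    rcases hnorm γ₀ hγ₀ with h | h
    · exact ⟨γ₀, hγ₀, h⟩
    · obtain ⟨η, hη⟩ := D.exists_unit_norm_eq_neg_one
      refine ⟨γ₀ * η, by rw [hγ₀, Ideal.span_singleton_mul_right_unit η.isUnit], ?_⟩
      rw [map_mul]
      linear_combination (γ₀ * D.σ γ₀) * hη - h
  have hγ0 : γ ≠ 0 := by
    rintro rfl; rw [zero_mul] at hγn; exact pow_ne_zero 2 hn0 hγn.symm
  have hrel : Ideal.span {γ} * I.map D.σ = Ideal.span {(n : 𝓞 K)} * I := by
    rw [← hγ, ← hIσ]; ring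
  have hγ0' : Ideal.span {γ} ≠ ⊥ := by rwa [Ne, Ideal.span_singleton_eq_bot]
  -- The factor n + σγ works because γ (n + σγ) = n (n + γ), while γ σI = n I as ideals. It vanishes
  -- only if γ = −n, and then I itself is invariant.
  by_cases hb : (n : 𝓞 K) + D.σ γ = 0
  · have hγe : γ = -(n : 𝓞 K) := by
      have := congrArg D.σ hb
      rw [map_add, D.invol, map_natCast, map_zero] at this
      exact eq_neg_of_add_eq_zero_right this
    rw [hγe, Ideal.span_singleton_neg] at hrel hγ0'
    obtain ⟨g, hg, -⟩ := D.exists_generator_of_map_eq I hI0 (mul_left_cancel₀ hγ0' hrel)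
    exact hnp ⟨⟨g, hg⟩⟩
  · have hinv : (Ideal.span {(n : 𝓞 K) + D.σ γ} * I).map D.σ =
        Ideal.span {(n : 𝓞 K) + D.σ γ} * I := by
      apply mul_left_cancel₀ hγ0'
      rw [Ideal.map_mul, D.map_span_singleton, mul_left_comm, hrel, ← mul_assoc, ← mul_assoc,
        Ideal.span_singleton_mul_span_singleton, Ideal.span_singleton_mul_span_singleton,
        map_add, D.invol, map_natCast]
      congr 3
      linear_combination -hγn
    obtain ⟨g, hg, -⟩ := D.exists_generator_of_map_eq _ (by
      rw [Ne, Ideal.mul_eq_bot, Ideal.span_singleton_eq_bot]; tauto) hinv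
    exact hcl _ hb g hg

end PrimeQuadratic

end

/-! ### Signatures of units and roots in the infinite component. -/

section

namespace PrimeQuadratic

variable {K : Type*} [Field K] [NumberField K] (D : PrimeQuadratic K)

/-- The real embedding attached to a place of the totally real field `K`. -/
def realEmb (D : PrimeQuadratic K) (v : InfinitePlace K) : K →+* ℝ :=
  InfinitePlace.embedding_of_isReal (D.isTotallyReal.isReal v)

theorem exists_realEmb_eq (v : InfinitePlace K) :
    ∃ w, ∀ x, D.realEmb w x = D.realEmb v (D.τ x) := by
  let φ : K →+* ℂ := v.embedding.comp D.τ.toRingHom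
  have hφ := D.isReal_embedding φ
  refine ⟨InfinitePlace.mk φ, fun x => ?_⟩
  have h := InfinitePlace.embedding_mk_eq_of_isReal hφ
  apply Complex.ofReal_injective
  rw [realEmb, realEmb, InfinitePlace.embedding_of_isReal_apply,
    InfinitePlace.embedding_of_isReal_apply, h]
  rfl

theorem norm_ne_neg_one_of_pos (u : (𝓞 K)ˣ) (hu : ∀ v, 0 < D.realEmb v (u : K)) :
    (u : 𝓞 K) * D.σ u ≠ -1 := by
  intro h
  obtain ⟨v⟩ : Nonempty (InfinitePlace K) := inferInstance
  obtain ⟨w, hw⟩ := D.exists_realEmb_eq v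
  have h1 : (u : K) * D.τ (u : K) = -1 := by
    have := congrArg (fun y : 𝓞 K => (y : K)) h
    simpa [D.coe_σ] using this
  have h2 := congrArg (D.realEmb v) h1
  rw [map_mul, ← hw, map_neg, map_one] at h2
  nlinarith [hu v, hu w, mul_pos (hu v) (hu w)]

/-- The units of `K` have all signatures. -/
theorem exists_unit_sign (f : InfinitePlace K → ℝ) (hf : ∀ v, f v ≠ 0) :
    ∃ u : (𝓞 K)ˣ, ∀ v, 0 < f v * D.realEmb v (u : K) := by
  classical
  obtain ⟨v₁, v₂, -, huniv⟩ := Finset.card_eq_two.1 (D.card_infinitePlace (K := K))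
  have hall : ∀ v : InfinitePlace K, v = v₁ ∨ v = v₂ := by
    intro v
    have := Finset.mem_univ v
    rw [huniv] at this
    simpa using this
  -- Neither η nor −η is totally positive, since their norm is −1; so η has opposite signs at the
  -- two places, and ±1, ±η realise all four signatures.
  obtain ⟨η, hη⟩ := D.exists_unit_norm_eq_neg_one
  have hpos := D.norm_ne_neg_one_of_pos η
  have hneg := D.norm_ne_neg_one_of_pos (-η)
  have hne0 : ∀ v, D.realEmb v (η : K) ≠ 0 := fun v => by
    rw [Ne, map_eq_zero]; exact Units.coe_ne_zero η
  have hη' : ((-η : (𝓞 K)ˣ) : 𝓞 K) * D.σ (-η : (𝓞 K)ˣ) = -1 := by simpa using hη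
  have hcoe : ((-η : (𝓞 K)ˣ) : K) = -(η : K) := by simp
  have hp : ¬ (0 < D.realEmb v₁ (η : K) ∧ 0 < D.realEmb v₂ (η : K)) := fun h => hpos (fun v => by
    rcases hall v with rfl | rfl <;> tauto) hη
  have hn : ¬ (D.realEmb v₁ (η : K) < 0 ∧ D.realEmb v₂ (η : K) < 0) := fun h => hneg (fun v => by
    rw [hcoe, map_neg, neg_pos]
    rcases hall v with rfl | rfl <;> tauto) hη'
  have h4 : ∃ u : (𝓞 K)ˣ, 0 < f v₁ * D.realEmb v₁ (u : K) ∧ 0 < f v₂ * D.realEmb v₂ (u : K) := by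
    rcases (hf v₁).lt_or_gt with h1 | h1 <;> rcases (hf v₂).lt_or_gt with h2 | h2
    · exact ⟨-1, by simpa using h1, by simpa using h2⟩
    · rcases (hne0 v₁).lt_or_gt with h3 | h3 <;> rcases (hne0 v₂).lt_or_gt with h4 | h4
      · tauto
      · exact ⟨η, mul_pos_of_neg_of_neg h1 h3, mul_pos h2 h4⟩
      · refine ⟨-η, ?_, ?_⟩ <;> rw [hcoe, map_neg]
        · exact mul_pos_of_neg_of_neg h1 (neg_neg_of_pos h3)
        · exact mul_pos h2 (neg_pos.2 h4)
      · tauto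
    · rcases (hne0 v₁).lt_or_gt with h3 | h3 <;> rcases (hne0 v₂).lt_or_gt with h4 | h4
      · tauto
      · refine ⟨-η, ?_, ?_⟩ <;> rw [hcoe, map_neg]
        · exact mul_pos h1 (neg_pos.2 h3)
        · exact mul_pos_of_neg_of_neg h2 (neg_neg_of_pos h4)
      · exact ⟨η, mul_pos h1 h3, mul_pos_of_neg_of_neg h2 h4⟩
      · tauto
    · exact ⟨1, by simpa using h1, by simpa using h2⟩
  obtain ⟨u, hu1, hu2⟩ := h4
  exact ⟨u, fun v => by rcases hall v with rfl | rfl <;> assumption⟩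

/-- The norm of units, as a homomorphism. -/
def unitNorm : (𝓞 K)ˣ →* 𝓞 K where
  toFun u := u * D.σ u
  map_one' := by simp
  map_mul' u w := by push_cast; rw [map_mul]; ring

/-- A totally positive unit is a square. -/
theorem exists_sq_of_pos (u : (𝓞 K)ˣ) (hu : ∀ v, 0 < D.realEmb v (u : K)) :
    ∃ w : (𝓞 K)ˣ, u = w ^ 2 := by
  obtain ⟨ε, hε, -⟩ := D.exists_fundamental_unit
  obtain ⟨v⟩ : Nonempty (InfinitePlace K) := inferInstance
  have hN : ∀ (w : (𝓞 K)ˣ), D.unitNorm (-w) = D.unitNorm w := fun w => by simp [unitNorm]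
  have hu1 : D.unitNorm u = 1 := (D.unit_norm_cases u).resolve_right (D.norm_ne_neg_one_of_pos u hu)
  -- If ε had norm 1, so would every ±ε^k, that is, every unit. Hence norm 1 forces an even
  -- exponent, and positivity then excludes the minus sign.
  have hε1 : D.unitNorm ε = -1 := by
    refine (D.unit_norm_cases ε).resolve_left fun h => ?_
    obtain ⟨η, hη⟩ := D.exists_unit_norm_eq_neg_one
    change D.unitNorm η = -1 at hη
    have h1 : D.unitNorm.toHomUnits ε = 1 := Units.ext h
    have : D.unitNorm η = 1 := by
      have h2 : ∀ k : ℤ, D.unitNorm (ε ^ k) = 1 := fun k => by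
        rw [← MonoidHom.coe_toHomUnits, map_zpow, h1, one_zpow]; rfl
      obtain ⟨k, rfl | rfl⟩ := hε η
      · exact h2 k
      · rw [hN]; exact h2 k
    rw [this] at hη
    norm_num at hη
  obtain ⟨k, hk⟩ := hε u
  have h1 : D.unitNorm.toHomUnits ε = -1 := Units.ext hε1
  have h2 : D.unitNorm (ε ^ k) = 1 := by rcases hk with rfl | rfl <;> simpa [hN] using hu1
  rw [← MonoidHom.coe_toHomUnits, map_zpow, h1] at h2
  have hev : Even k := by
    by_contra hodd
    rw [Int.not_even_iff_odd] at hodd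
    rw [hodd.neg_one_zpow] at h2
    norm_num at h2
  obtain ⟨m, rfl⟩ := hev
  refine ⟨ε ^ m, ?_⟩
  rcases hk with h | h
  · rw [h, zpow_add, pow_two]
  · exfalso
    have h3 := hu v
    rw [h, zpow_add] at h3
    have : ((-(ε ^ m * ε ^ m) : (𝓞 K)ˣ) : K) =
        -(((ε ^ m : (𝓞 K)ˣ) : K) * ((ε ^ m : (𝓞 K)ˣ) : K)) := by
      simp
    rw [this, map_neg, map_mul] at h3
    nlinarith [mul_self_nonneg (D.realEmb v ((ε ^ m : (𝓞 K)ˣ) : K))]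

end PrimeQuadratic

/-! ### The infinite component -/

section Infinite

variable {K : Type*} [Field K]

/-- The image of a global unit in the units of the infinite adele ring. -/
def unitInf (u : (𝓞 K)ˣ) : (InfiniteAdeleRing K)ˣ :=
  Units.map (algebraMap K (InfiniteAdeleRing K)).toMonoidHom
    (Units.map (algebraMap (𝓞 K) K).toMonoidHom u)

theorem unitInf_mul (u w : (𝓞 K)ˣ) : unitInf (u * w) = unitInf u * unitInf w := by
  simp [unitInf]

theorem val_apply_ne_zero (y : (InfiniteAdeleRing K)ˣ) (v : InfinitePlace K) :
    (y : InfiniteAdeleRing K) v ≠ 0 := by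
  intro h
  have := congrFun y.mul_inv v
  change (y : InfiniteAdeleRing K) v * _ = 1 at this
  rw [h, zero_mul] at this
  exact zero_ne_one this

theorem exists_pow_eq (y : (InfiniteAdeleRing K)ˣ) {n : ℕ} (hn : n ≠ 0)
    (h : ∀ v, ∃ z : v.Completion, z ^ n = (y : InfiniteAdeleRing K) v) :
    ∃ z : (InfiniteAdeleRing K)ˣ, z ^ n = y := by
  choose z hz using h
  have hz0 : ∀ v, z v ≠ 0 := fun v h0 => val_apply_ne_zero y v (by rw [← hz, h0, zero_pow hn])
  let z' : InfiniteAdeleRing K := z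
  let zi : InfiniteAdeleRing K := fun v => (z v)⁻¹
  refine ⟨⟨z', zi, ?_, ?_⟩, ?_⟩
  · funext v; exact mul_inv_cancel₀ (hz0 v)
  · funext v; exact inv_mul_cancel₀ (hz0 v)
  · apply Units.ext
    funext v
    exact hz v

open InfinitePlace.Completion in
theorem exists_pow_eq_of_isComplex {v : InfinitePlace K} (hv : v.IsComplex) (x : v.Completion)
    {n : ℕ} (hn : n ≠ 0) : ∃ z, z ^ n = x := by
  obtain ⟨z, hz⟩ := IsAlgClosed.exists_pow_nat_eq (ringEquivComplexOfIsComplex hv x)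
    (Nat.pos_of_ne_zero hn)
  refine ⟨(ringEquivComplexOfIsComplex hv).symm z, ?_⟩
  rw [← map_pow, hz, RingEquiv.symm_apply_apply]

open InfinitePlace.Completion in
theorem exists_pow_eq_of_isReal {v : InfinitePlace K} (hv : v.IsReal) (x : v.Completion)
    (hx : 0 < extensionEmbeddingOfIsReal hv x) {n : ℕ} (hn : n ≠ 0) : ∃ z, z ^ n = x := by
  refine ⟨(ringEquivRealOfIsReal hv).symm ((extensionEmbeddingOfIsReal hv x) ^ (n⁻¹ : ℝ)), ?_⟩
  rw [← map_pow, Real.rpow_inv_natCast_pow hx.le hn, ← ringEquivRealOfIsReal_apply,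
    RingEquiv.symm_apply_apply]

open InfinitePlace.Completion in
-- A real number at distance less than 1 from 1 is positive. This supplies the neighbourhood at
-- infinity needed for continuity.
theorem exists_pow_eq_of_norm_sub_one_lt {v : InfinitePlace K} (x : v.Completion)
    (hx : ‖x - 1‖ < 1) {n : ℕ} (hn : n ≠ 0) : ∃ z, z ^ n = x := by
  by_cases hv : v.IsReal
  · apply exists_pow_eq_of_isReal hv x _ hn
    have h1 := (isometry_extensionEmbeddingOfIsReal hv).norm_map_of_map_zero (map_zero _) (x - 1)
    rw [← h1, map_sub, map_one, Real.norm_eq_abs] at hx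
    linarith [(abs_lt.1 hx).1]
  · exact exists_pow_eq_of_isComplex (InfinitePlace.not_isReal_iff_isComplex.1 hv) x hn

theorem exists_unitInf_mul_pow_of_isTotallyComplex [IsTotallyComplex K]
    (y : (InfiniteAdeleRing K)ˣ) {n : ℕ} (hn : n ≠ 0) : ∃ u z, y = unitInf u * z ^ n := by
  obtain ⟨z, hz⟩ := exists_pow_eq y hn fun v =>
    exists_pow_eq_of_isComplex (IsTotallyComplex.isComplex v) _ hn
  exact ⟨1, z, by rw [hz]; simp [unitInf]⟩

end Infinite

namespace PrimeQuadratic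

variable {K : Type*} [Field K] [NumberField K]

open InfinitePlace.Completion in
-- A unit with the signature of y makes the product positive at both real places, where positive
-- elements have n-th roots.
theorem exists_unitInf_mul_pow (D : PrimeQuadratic K) (y : (InfiniteAdeleRing K)ˣ)
    {n : ℕ} (hn : n ≠ 0) : ∃ u z, y = unitInf u * z ^ n := by
  have hr := D.isTotallyReal.isReal
  obtain ⟨u, hu⟩ := D.exists_unit_sign
    (fun v => extensionEmbeddingOfIsReal (hr v) ((y : InfiniteAdeleRing K) v))
    (fun v => by rw [Ne, map_eq_zero]; exact val_apply_ne_zero y v)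
  obtain ⟨z, hz⟩ := exists_pow_eq (unitInf u * y) hn fun v => by
    apply exists_pow_eq_of_isReal (hr v) _ _ hn
    change 0 < extensionEmbeddingOfIsReal (hr v)
      (((u : K) : v.Completion) * (y : InfiniteAdeleRing K) v)
    rw [map_mul, mul_comm]
    convert hu v
    exact extensionEmbeddingOfIsReal_coe _ _
  refine ⟨u⁻¹, z, ?_⟩
  rw [hz, ← mul_assoc, ← unitInf_mul]
  simp [unitInf]

open InfinitePlace.Completion in
theorem exists_sq_of_unitInf_eq_sq (D : PrimeQuadratic K) (u : (𝓞 K)ˣ) (z : (InfiniteAdeleRing K)ˣ)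
    (h : unitInf u = z ^ 2) : ∃ w : (𝓞 K)ˣ, u = w ^ 2 := by
  have hr := D.isTotallyReal.isReal
  apply D.exists_sq_of_pos
  intro v
  have h1 : ((u : K) : v.Completion) = ((z : InfiniteAdeleRing K) v) ^ 2 :=
    congrFun (congrArg Units.val h) v
  have h2 : D.realEmb v (u : K) = extensionEmbeddingOfIsReal (hr v) ((u : K) : v.Completion) :=
    (extensionEmbeddingOfIsReal_coe (hr v) _).symm
  rw [h2, h1, map_pow]
  have h3 : extensionEmbeddingOfIsReal (hr v) ((z : InfiniteAdeleRing K) v) ≠ 0 := by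
    rw [Ne, map_eq_zero]; exact val_apply_ne_zero z v
  positivity

end PrimeQuadratic

end

/-! ### Extension of characters along powers, and the structure of ideles. -/

section

/-- The value θ a depends only on x: two choices of a differ by an element that f sends into P,
which θ kills. It serves with N = 1 at infinity and with N = h m for the ideles, P being the
principal ones. -/
theorem exists_monoidHom_of_pow_eq {A G C : Type*} [CommGroup A] [CommGroup G] [CommGroup C]
    (P : Subgroup G) (f : A →* G) (θ : A →* C) (hθ : ∀ a, f a ∈ P → θ a = 1) (N : ℕ)
    (h : ∀ x : G, ∃ p ∈ P, ∃ a, x ^ N = p * f a) :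
    ∃ χ : G →* C, ∀ x, ∀ p ∈ P, ∀ a, x ^ N = p * f a → χ x = θ a := by
  choose p hp a ha using h
  have key : ∀ x, ∀ q ∈ P, ∀ b, x ^ N = q * f b → θ (a x) = θ b := by
    intro x q hq b hb
    rw [← div_eq_one, ← map_div]
    apply hθ
    have : f (a x / b) = q * (p x)⁻¹ := by
      have h1 := (ha x).symm.trans hb
      rw [map_div, div_eq_iff_eq_mul, mul_right_comm, ← h1, mul_comm (p x), mul_inv_cancel_right]
    rw [this]
    exact P.mul_mem hq (P.inv_mem (hp x))
  refine ⟨MonoidHom.mk' (fun x => θ (a x)) fun x y => ?_, fun x q hq b hb => key x q hq b hb⟩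
  rw [← map_mul]
  apply key _ (p x * p y) (P.mul_mem (hp x) (hp y))
  rw [mul_pow, ha x, ha y, map_mul, mul_mul_mul_comm]

variable {K : Type*} [Field K] [NumberField K]

theorem finComp_mul (x y : Ideles K) (v : HeightOneSpectrum (𝓞 K)) :
    finComp (x * y) v = finComp x v * finComp y v := rfl

theorem finComp_one (v : HeightOneSpectrum (𝓞 K)) : finComp (1 : Ideles K) v = 1 := rfl

/-- The component of an idele at a finite place, as a homomorphism. -/
def finCompHom (v : HeightOneSpectrum (𝓞 K)) : Ideles K →* v.adicCompletion K where
  toFun x := finComp x v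
  map_one' := rfl
  map_mul' _ _ := rfl

theorem finComp_mul_inv (x : Ideles K) (v : HeightOneSpectrum (𝓞 K)) :
    finComp x v * finComp x⁻¹ v = 1 := by
  rw [← finComp_mul, mul_inv_cancel, finComp_one]

theorem valued_finComp_ne_zero (x : Ideles K) (v : HeightOneSpectrum (𝓞 K)) :
    Valued.v (finComp x v) ≠ 0 := by
  rw [Ne, map_eq_zero]
  exact left_ne_zero_of_mul_eq_one (finComp_mul_inv x v)

/-- The infinite component, as a homomorphism to the units of the infinite adele ring. -/
def infHom : Ideles K →* (InfiniteAdeleRing K)ˣ :=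
  Units.map ⟨⟨fun x : AdeleRing (𝓞 K) K => x.1, rfl⟩, fun _ _ => rfl⟩

theorem val_infHom (x : Ideles K) : (infHom x : InfiniteAdeleRing K) = infPart x := rfl

theorem infPart_eq_one_iff (x : Ideles K) : infPart x = 1 ↔ infHom x = 1 := by
  rw [← val_infHom, Units.val_eq_one]

/-- The ideles whose finite components are units. -/
def unitIdeles (K : Type*) [Field K] [NumberField K] : Subgroup (Ideles K) where
  carrier := {x | ∀ v, Valued.v (finComp x v) = 1}
  one_mem' v := by rw [finComp_one, map_one]
  mul_mem' {x y} hx hy v := by rw [finComp_mul, map_mul, hx v, hy v, one_mul]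
  inv_mem' {x} hx v := by
    have := congrArg Valued.v (finComp_mul_inv x v)
    rwa [map_mul, hx v, one_mul, map_one] at this

theorem mem_unitIdeles {x : Ideles K} : x ∈ unitIdeles K ↔ ∀ v, Valued.v (finComp x v) = 1 :=
  Iff.rfl

theorem mem_finiteUnitIdeles {x : Ideles K} :
    x ∈ finiteUnitIdeles K ↔ infHom x = 1 ∧ x ∈ unitIdeles K := by
  rw [← infPart_eq_one_iff]; rfl

/-- The principal idele attached to an element of `K^×`. -/
abbrev principal : Kˣ →* Ideles K :=
  Units.map (algebraMap K (AdeleRing (𝓞 K) K)).toMonoidHom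

theorem finComp_principal (a : Kˣ) (v : HeightOneSpectrum (𝓞 K)) :
    finComp (principal a) v = ((a : K) : v.adicCompletion K) := rfl

/-- The idele with prescribed infinite component and prescribed unit components at the
finite places. -/
def mkIdele (y : (InfiniteAdeleRing K)ˣ) (f : ∀ v : HeightOneSpectrum (𝓞 K), v.adicCompletion K)
    (hf : ∀ v, Valued.v (f v) = 1) : Ideles K where
  val := (((y : InfiniteAdeleRing K), ⟨f, Filter.Eventually.of_forall fun v => (hf v).le⟩) :
    InfiniteAdeleRing K × FiniteAdeleRing (𝓞 K) K)
  inv := (((y⁻¹ : (InfiniteAdeleRing K)ˣ) : InfiniteAdeleRing K),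
    ⟨fun v => (f v)⁻¹, Filter.Eventually.of_forall fun v => by
      change Valued.v (f v)⁻¹ ≤ 1
      rw [map_inv₀, hf v, inv_one]⟩)
  val_inv := by
    refine Prod.ext (y.mul_inv) (FiniteAdeleRing.ext K fun v => ?_)
    have hv : f v ≠ 0 := fun h => zero_ne_one <| by rw [← hf v, h, map_zero]
    exact mul_inv_cancel₀ hv
  inv_val := by
    refine Prod.ext (y.inv_mul) (FiniteAdeleRing.ext K fun v => ?_)
    have hv : f v ≠ 0 := fun h => zero_ne_one <| by rw [← hf v, h, map_zero]
    exact inv_mul_cancel₀ hv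

theorem infHom_mkIdele (y : (InfiniteAdeleRing K)ˣ)
    (f : ∀ v : HeightOneSpectrum (𝓞 K), v.adicCompletion K) (hf : ∀ v, Valued.v (f v) = 1) :
    infHom (mkIdele y f hf) = y := Units.ext rfl

theorem finComp_mkIdele (y : (InfiniteAdeleRing K)ˣ)
    (f : ∀ v : HeightOneSpectrum (𝓞 K), v.adicCompletion K) (hf : ∀ v, Valued.v (f v) = 1)
    (v : HeightOneSpectrum (𝓞 K)) : finComp (mkIdele y f hf) v = f v := rfl

theorem ideles_ext {x y : Ideles K} (h : infHom x = infHom y)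
    (h' : ∀ v, finComp x v = finComp y v) :
    x = y := by
  apply Units.ext
  exact Prod.ext (congrArg Units.val h) (FiniteAdeleRing.ext K h')

/-- A unit idele is the product of its infinite and its finite components. -/
theorem exists_eq_mkIdele_mul (x : Ideles K) (hx : x ∈ unitIdeles K) :
    ∃ z ∈ finiteUnitIdeles K, x = mkIdele (infHom x) (fun _ => 1) (fun _ => map_one _) * z := by
  refine ⟨mkIdele 1 (finComp x) (mem_unitIdeles.1 hx), ?_, ?_⟩
  · rw [mem_finiteUnitIdeles]
    exact ⟨infHom_mkIdele _ _ _, hx⟩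
  · apply ideles_ext
    · rw [map_mul, infHom_mkIdele, infHom_mkIdele, mul_one]
    · intro v
      rw [finComp_mul, finComp_mkIdele, finComp_mkIdele, one_mul]

/-! ### Principal ideles and class number -/

theorem exists_valuation_eq (v : HeightOneSpectrum (𝓞 K)) : ∃ a : Kˣ,
    v.valuation K a = WithZero.exp (-(classNumber K : ℤ)) ∧ ∀ w, w ≠ v → w.valuation K a = 1 := by
  have hv0 : v.asIdeal ^ classNumber K ∈ nonZeroDivisors (Ideal (𝓞 K)) :=
    pow_mem (mem_nonZeroDivisors_of_ne_zero v.ne_bot) _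
  have hp : (v.asIdeal ^ classNumber K).IsPrincipal := by
    rw [← ClassGroup.mk0_eq_one_iff hv0]
    have : ClassGroup.mk0 ⟨v.asIdeal, mem_nonZeroDivisors_of_ne_zero v.ne_bot⟩ ^
        classNumber K = 1 :=
      pow_card_eq_one
    rw [← this, ← map_pow]
    rfl
  obtain ⟨⟨g, hg⟩⟩ := hp
  change v.asIdeal ^ classNumber K = Ideal.span {g} at hg
  have hg0 : g ≠ 0 := by
    rintro rfl
    rw [Ideal.span_singleton_zero] at hg
    exact nonZeroDivisors.ne_zero hv0 hg
  refine ⟨Units.mk0 (g : K) (by simpa using hg0), ?_, fun w hw => ?_⟩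
  · change v.valuation K (algebraMap (𝓞 K) K g) = _
    rw [HeightOneSpectrum.valuation_of_algebraMap,
      HeightOneSpectrum.intValuation_eq_exp_neg_multiplicity _ hg0, ← hg,
      multiplicity_pow_self v.ne_bot]
    exact v.prime.not_isUnit
  · change w.valuation K (algebraMap (𝓞 K) K g) = _
    rw [HeightOneSpectrum.valuation_eq_one_iff_notMem]
    intro hgw
    have h1 : v.asIdeal ^ classNumber K ≤ w.asIdeal := by
      rw [hg]; exact (Ideal.span_singleton_le_iff_mem _).2 hgw
    have h2 := w.isPrime.le_of_pow_le h1
    apply hw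
    apply HeightOneSpectrum.ext
    exact (v.isMaximal.eq_of_le w.isPrime.ne_top h2).symm

theorem finite_valued_ne_one (x : Ideles K) :
    {v : HeightOneSpectrum (𝓞 K) | Valued.v (finComp x v) ≠ 1}.Finite := by
  have h1 : ∀ y : Ideles K, ∀ᶠ v in Filter.cofinite, Valued.v (finComp y v) ≤ 1 :=
    fun y => (y : AdeleRing (𝓞 K) K).2.2
  have h2 := (h1 x).and (h1 x⁻¹)
  rw [Filter.eventually_cofinite] at h2
  apply h2.subset
  intro v hv h
  apply hv
  have h3 := congrArg Valued.v (finComp_mul_inv x v)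
  rw [map_mul, map_one] at h3
  exact eq_one_of_one_le_mul_left h.1 h.2 h3.ge

theorem exists_pow_classNumber_eq (x : Ideles K) :
    ∃ (a : Kˣ), ∃ w ∈ unitIdeles K, x ^ classNumber K = principal a * w := by
  choose g hg hg' using exists_valuation_eq (K := K)
  let S := (finite_valued_ne_one x).toFinset
  -- As `g v` has valuation exp(−h) at v and 1 at other finite places, the exponent −log |x_v| gives
  -- a the valuation |x_v|^h at v.
  let a : Kˣ := ∏ v ∈ S, g v ^ (-WithZero.log (Valued.v (finComp x v)))
  refine ⟨a, (principal a)⁻¹ * x ^ classNumber K, ?_, by rw [mul_inv_cancel_left]⟩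
  intro v
  have ha : v.valuation K (a : K) = Valued.v (finComp x v) ^ classNumber K := by
    simp only [a, Units.coe_prod, map_prod, Units.val_zpow_eq_zpow_val, map_zpow₀]
    rw [Finset.prod_eq_single v]
    · rw [hg]
      nth_rewrite 2 [← WithZero.exp_log (valued_finComp_ne_zero x v)]
      rw [← WithZero.exp_zsmul, ← WithZero.exp_nsmul]
      congr 1
      simp [mul_comm]
    · intro w _ hwv
      rw [hg' w v (Ne.symm hwv), one_zpow]
    · intro hv
      have : Valued.v (finComp x v) = 1 := by
        by_contra h
        exact hv ((finite_valued_ne_one x).mem_toFinset.2 h)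
      rw [this]; simp
  have h1 : finComp (x ^ classNumber K) v = finComp x v ^ classNumber K :=
    map_pow (finCompHom v) x _
  have h2 := congrArg Valued.v (finComp_mul_inv (principal a) v)
  rw [map_mul, map_one, finComp_principal, HeightOneSpectrum.valuedAdicCompletion_eq_valuation', ha]
    at h2
  rw [finComp_mul, map_mul, h1, map_pow, mul_comm]
  exact h2

theorem exists_unit_of_principal_mem (a : Kˣ) (ha : principal a ∈ unitIdeles K) :
    ∃ u : (𝓞 K)ˣ, (u : K) = a := by
  have h : ∀ b : Kˣ, principal b ∈ unitIdeles K → ∃ r : 𝓞 K, (r : K) = b := by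
    intro b hb
    obtain ⟨r, hr⟩ := HeightOneSpectrum.mem_integers_of_valuation_le_one (R := 𝓞 K) K (b : K)
      fun v => by
        rw [← HeightOneSpectrum.valuedAdicCompletion_eq_valuation', ← finComp_principal, hb v]
    exact ⟨r, hr⟩
  obtain ⟨r, hr⟩ := h a ha
  obtain ⟨s, hs⟩ := h a⁻¹ (by rw [map_inv]; exact inv_mem ha)
  have hrs : r * s = 1 := by
    apply RingOfIntegers.ext
    have h1 : ((r * s : 𝓞 K) : K) = r * s := map_mul _ _ _
    rw [h1, hr, hs]
    simp
  exact ⟨⟨r, s, hrs, by rw [mul_comm, hrs]⟩, hr⟩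

end

/-! ### Congruences modulo 𝔞 and the reduction of unit ideles. -/

section

variable {K : Type*} [Field K] [NumberField K]

theorem coe_sub_coe (v : HeightOneSpectrum (𝓞 K)) (a b : K) :
    (a : v.adicCompletion K) - (b : v.adicCompletion K) = ((a - b : K) : v.adicCompletion K) :=
  (map_sub (algebraMap K (v.adicCompletion K)) a b).symm

theorem coe_int_sub (v : HeightOneSpectrum (𝓞 K)) (r s : 𝓞 K) :
    (((r - s : 𝓞 K) : K) : v.adicCompletion K) =
      ((r : K) : v.adicCompletion K) - ((s : K) : v.adicCompletion K) :=
  map_sub ((algebraMap K (v.adicCompletion K)).comp (algebraMap (𝓞 K) K)) r s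

theorem coe_int_mul (v : HeightOneSpectrum (𝓞 K)) (r s : 𝓞 K) :
    (((r * s : 𝓞 K) : K) : v.adicCompletion K) =
      ((r : K) : v.adicCompletion K) * ((s : K) : v.adicCompletion K) :=
  map_mul ((algebraMap K (v.adicCompletion K)).comp (algebraMap (𝓞 K) K)) r s

theorem coe_int_one (v : HeightOneSpectrum (𝓞 K)) :
    (((1 : 𝓞 K) : K) : v.adicCompletion K) = 1 :=
  map_one ((algebraMap K (v.adicCompletion K)).comp (algebraMap (𝓞 K) K))

theorem isOpen_valued_le (v : HeightOneSpectrum (𝓞 K)) (n : ℤ) :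
    IsOpen {y : v.adicCompletion K | Valued.v y ≤ WithZero.exp n} := by
  obtain ⟨π, hπ⟩ := HeightOneSpectrum.valuedAdicCompletion_surjective K v (WithZero.exp n)
  have hπ0 : (Valued.v : Valuation (v.adicCompletion K) _).restrict π ≠ 0 := by
    rw [Ne, Valuation.restrict_eq_zero_iff, hπ]
    exact WithZero.exp_ne_zero
  have := Valued.isOpen_closedBall (v.adicCompletion K) hπ0
  simpa only [Valuation.restrict_le_iff, hπ] using this

theorem valued_coe_le_iff (v : HeightOneSpectrum (𝓞 K)) (r : 𝓞 K) (n : ℕ) :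
    Valued.v ((r : K) : v.adicCompletion K) ≤ WithZero.exp (-(n : ℤ)) ↔ r ∈ v.asIdeal ^ n := by
  rw [HeightOneSpectrum.valuedAdicCompletion_eq_valuation']
  change v.valuation K (algebraMap (𝓞 K) K r) ≤ _ ↔ _
  rw [HeightOneSpectrum.valuation_of_algebraMap, HeightOneSpectrum.intValuation_le_pow_iff_mem]

theorem valued_coe_le_one (v : HeightOneSpectrum (𝓞 K)) (r : 𝓞 K) :
    Valued.v ((r : K) : v.adicCompletion K) ≤ 1 := by
  simpa using (valued_coe_le_iff v r 0).2 (by simp)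

theorem valued_coe_eq_one (v : HeightOneSpectrum (𝓞 K)) {r : 𝓞 K} (hr : r ∉ v.asIdeal) :
    Valued.v ((r : K) : v.adicCompletion K) = 1 := by
  rw [HeightOneSpectrum.valuedAdicCompletion_eq_valuation']
  exact (HeightOneSpectrum.valuation_eq_one_iff_notMem v).2 hr

theorem valued_sub_coe_le_of_sub_mem (v : HeightOneSpectrum (𝓞 K)) {x : v.adicCompletion K}
    {r s : 𝓞 K} {n : ℕ} (h : r - s ∈ v.asIdeal ^ n)
    (hx : Valued.v (x - ((r : K) : v.adicCompletion K)) ≤ WithZero.exp (-(n : ℤ))) :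
    Valued.v (x - ((s : K) : v.adicCompletion K)) ≤ WithZero.exp (-(n : ℤ)) := by
  have h1 : x - ((s : K) : v.adicCompletion K) = (x - ((r : K) : v.adicCompletion K)) +
      (((r - s : 𝓞 K) : K) : v.adicCompletion K) := by
    rw [coe_int_sub]; ring
  rw [h1]
  exact Valuation.map_add_le _ hx ((valued_coe_le_iff v _ _).2 h)

/-- Local integers are congruent to global integers modulo powers of the maximal ideal. -/
theorem exists_coe_congr (v : HeightOneSpectrum (𝓞 K)) (x : v.adicCompletion K)
    (hx : Valued.v x ≤ 1) (n : ℕ) :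
    ∃ r : 𝓞 K, Valued.v (x - ((r : K) : v.adicCompletion K)) ≤ WithZero.exp (-(n : ℤ)) := by
  let γ : (WithZero (Multiplicative ℤ))ˣ := Units.mk0 (WithZero.exp (-(n : ℤ))) WithZero.exp_ne_zero
  have hγ1 : WithZero.exp (-(n : ℤ)) ≤ 1 := by
    rw [← WithZero.exp_zero, WithZero.exp_le_exp]; omega
  have hopen : IsOpen {y : v.adicCompletion K | Valued.v (y - x) ≤ WithZero.exp (-(n : ℤ))} :=
    (isOpen_valued_le v _).preimage (continuous_id.sub continuous_const)
  obtain ⟨k, hk⟩ := (HeightOneSpectrum.denseRange_algebraMap K v).exists_mem_open hopen ⟨x, by simp⟩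
  change Valued.v ((k : v.adicCompletion K) - x) ≤ _ at hk
  have hk1 : v.valuation K k ≤ 1 := by
    rw [← HeightOneSpectrum.valuedAdicCompletion_eq_valuation']
    have : (k : v.adicCompletion K) = ((k : v.adicCompletion K) - x) + x := by ring
    rw [this]
    exact Valuation.map_add_le _ (hk.trans hγ1) hx
  obtain ⟨r, hr⟩ := HeightOneSpectrum.exists_valuation_sub_lt_of_integer v hk1 γ
  refine ⟨r, ?_⟩
  have h2 : x - ((r : K) : v.adicCompletion K) =
      -((k : v.adicCompletion K) - x) + -((((r : K) - k : K)) : v.adicCompletion K) := by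
    rw [← coe_sub_coe]; ring
  rw [h2]
  refine Valuation.map_add_le _ (by rwa [Valuation.map_neg]) ?_
  rw [Valuation.map_neg, HeightOneSpectrum.valuedAdicCompletion_eq_valuation']
  exact hr.le

variable {𝔞 : Ideal (𝓞 K)}

theorem pow_dvd_iff_le_multiplicity (h𝔞 : 𝔞 ≠ ⊥) (v : HeightOneSpectrum (𝓞 K)) (n : ℕ) :
    v.asIdeal ^ n ∣ 𝔞 ↔ n ≤ multiplicity v.asIdeal 𝔞 :=
  (FiniteMultiplicity.of_prime_left v.prime h𝔞).pow_dvd_iff_le_multiplicity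

theorem finite_dvd (h𝔞 : 𝔞 ≠ ⊥) : {v : HeightOneSpectrum (𝓞 K) | v.asIdeal ∣ 𝔞}.Finite :=
  Ideal.finite_factors h𝔞

theorem congrMod_iff (h𝔞 : 𝔞 ≠ ⊥) (x : Ideles K) (r : 𝓞 K) : CongrMod 𝔞 x r ↔
    ∀ v, Valued.v (finComp x v - ((r : K) : v.adicCompletion K)) ≤
      WithZero.exp (-(multiplicity v.asIdeal 𝔞 : ℤ)) := by
  refine ⟨fun h v => h v _ ((pow_dvd_iff_le_multiplicity h𝔞 v _).2 le_rfl), fun h v n hn => ?_⟩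
  rw [pow_dvd_iff_le_multiplicity h𝔞] at hn
  refine (h v).trans ?_
  rw [WithZero.exp_le_exp]
  omega

theorem mem_of_forall_mem_pow (h𝔞 : 𝔞 ≠ ⊥) {r : 𝓞 K}
    (h : ∀ v : HeightOneSpectrum (𝓞 K), r ∈ v.asIdeal ^ multiplicity v.asIdeal 𝔞) : r ∈ 𝔞 := by
  rw [← Ideal.iInf_maxPowDividing_eq h𝔞]
  simp only [Ideal.mem_iInf]
  intro v
  rw [HeightOneSpectrum.maxPowDividing_eq_pow_multiplicity h𝔞]
  exact h v

theorem mk_eq_of_congrMod (h𝔞 : 𝔞 ≠ ⊥) {x : Ideles K} {r s : 𝓞 K} (hr : CongrMod 𝔞 x r)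
    (hs : CongrMod 𝔞 x s) : Ideal.Quotient.mk 𝔞 r = Ideal.Quotient.mk 𝔞 s := by
  rw [Ideal.Quotient.eq]
  apply mem_of_forall_mem_pow h𝔞
  intro v
  rw [← valued_coe_le_iff]
  have h1 : (((r - s : 𝓞 K) : K) : v.adicCompletion K) =
      (finComp x v - ((s : K) : v.adicCompletion K)) +
        -(finComp x v - ((r : K) : v.adicCompletion K)) := by
    rw [coe_int_sub]; ring
  rw [h1]
  exact Valuation.map_add_le _ ((congrMod_iff h𝔞 x s).1 hs v)
    (by rw [Valuation.map_neg]; exact (congrMod_iff h𝔞 x r).1 hr v)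

theorem CongrMod.mul {x y : Ideles K} (hy : y ∈ unitIdeles K) {r s : 𝓞 K} (hr : CongrMod 𝔞 x r)
    (hs : CongrMod 𝔞 y s) : CongrMod 𝔞 (x * y) (r * s) := by
  intro v n hn
  have h1 : finComp (x * y) v - (((r * s : 𝓞 K) : K) : v.adicCompletion K) =
      (finComp x v - ((r : K) : v.adicCompletion K)) * finComp y v +
        ((r : K) : v.adicCompletion K) * (finComp y v - ((s : K) : v.adicCompletion K)) := by
    rw [coe_int_mul, finComp_mul]; ring
  rw [h1]
  refine Valuation.map_add_le _ ?_ ?_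
  · rw [map_mul, hy v, mul_one]; exact hr v n hn
  · rw [map_mul]
    exact (mul_le_of_le_one_left' (valued_coe_le_one v r)).trans (hs v n hn)

/-- The Chinese remainder theorem glues local approximations at the places dividing 𝔞; elsewhere the
condition is only integrality. -/
theorem exists_congrMod (h𝔞 : 𝔞 ≠ ⊥) {x : Ideles K} (hx : x ∈ unitIdeles K) :
    ∃ r, CongrMod 𝔞 x r := by
  choose g hg using fun v : HeightOneSpectrum (𝓞 K) =>
    exists_coe_congr v (finComp x v) (hx v).le (multiplicity v.asIdeal 𝔞)
  obtain ⟨r, hr⟩ := IsDedekindDomain.exists_forall_sub_mem_ideal (s := (finite_dvd h𝔞).toFinset)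
    (fun v : HeightOneSpectrum (𝓞 K) => v.asIdeal) (fun v => multiplicity v.asIdeal 𝔞)
    (fun v _ => v.prime) (fun v _ w _ hvw h => hvw (HeightOneSpectrum.ext h)) (fun v => g v)
  refine ⟨r, (congrMod_iff h𝔞 x r).2 fun v => ?_⟩
  by_cases hv : v.asIdeal ∣ 𝔞
  · refine valued_sub_coe_le_of_sub_mem v ?_ (hg v)
    have := hr v ((finite_dvd h𝔞).mem_toFinset.2 hv)
    rw [← neg_mem_iff, neg_sub]
    exact this
  · rw [multiplicity_eq_zero.2 hv]
    have : Valued.v (finComp x v - ((r : K) : v.adicCompletion K)) ≤ 1 :=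
      Valuation.map_sub_le _ (hx v).le (valued_coe_le_one v r)
    simpa using this

theorem congrMod_one : CongrMod 𝔞 (1 : Ideles K) 1 := by
  intro v n _
  have : finComp (1 : Ideles K) v - (((1 : 𝓞 K) : K) : v.adicCompletion K) = 0 := by
    rw [finComp_one, coe_int_one, sub_self]
  rw [this, map_zero]
  exact zero_le

/-- The reduction map `∏ U_v → (𝓞 K / 𝔞)^×`. -/
def residue (h𝔞 : 𝔞 ≠ ⊥) : unitIdeles K →* (𝓞 K ⧸ 𝔞)ˣ :=
  MonoidHom.toHomUnits
    { toFun := fun x => Ideal.Quotient.mk 𝔞 (exists_congrMod h𝔞 x.2).choose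
      map_one' := by
        rw [← map_one (Ideal.Quotient.mk 𝔞)]
        exact mk_eq_of_congrMod h𝔞 (exists_congrMod h𝔞 (unitIdeles K).one_mem).choose_spec
          congrMod_one
      map_mul' := fun x y => by
        rw [← map_mul]
        exact mk_eq_of_congrMod h𝔞 (exists_congrMod h𝔞 (x * y).2).choose_spec
          ((exists_congrMod h𝔞 x.2).choose_spec.mul y.2 (exists_congrMod h𝔞 y.2).choose_spec) }

theorem residue_eq (h𝔞 : 𝔞 ≠ ⊥) (x : unitIdeles K) {r : 𝓞 K} (h : CongrMod 𝔞 (x : Ideles K) r) :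
    (residue h𝔞 x : 𝓞 K ⧸ 𝔞) = Ideal.Quotient.mk 𝔞 r :=
  mk_eq_of_congrMod h𝔞 (exists_congrMod h𝔞 x.2).choose_spec h

/-- Every residue class prime to `𝔞` comes from an idele of finite units, and a residue class
which is `1` modulo `𝔟` comes from an idele which is supported at the places where the
multiplicities of `𝔞` and `𝔟` differ. -/
theorem exists_finiteUnitIdeles_congrMod (r : 𝓞 K) (hr : IsUnit (Ideal.Quotient.mk 𝔞 r))
    (T : Set (HeightOneSpectrum (𝓞 K))) (hT : ∀ v ∈ T, v.asIdeal ∣ 𝔞)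
    (h : ∀ v ∉ T, ∀ n, v.asIdeal ^ n ∣ 𝔞 → r - 1 ∈ v.asIdeal ^ n) :
    ∃ x ∈ finiteUnitIdeles K, CongrMod 𝔞 x r ∧ (∀ v ∉ T, finComp x v = 1) ∧
      ∀ v ∈ T, finComp x v = ((r : K) : v.adicCompletion K) := by
  classical
  have hrv : ∀ v : HeightOneSpectrum (𝓞 K), v.asIdeal ∣ 𝔞 → r ∉ v.asIdeal := by
    intro v hv hrv
    obtain ⟨b, hb⟩ := hr.exists_right_inv
    obtain ⟨b, rfl⟩ := Ideal.Quotient.mk_surjective b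
    rw [← map_mul, ← map_one (Ideal.Quotient.mk 𝔞), Ideal.Quotient.eq] at hb
    have h1 := Ideal.dvd_iff_le.1 hv hb
    apply v.isPrime.ne_top
    rw [Ideal.eq_top_iff_one]
    have := sub_mem (Ideal.mul_mem_right b _ hrv) h1
    simpa using this
  let f : ∀ v : HeightOneSpectrum (𝓞 K), v.adicCompletion K := fun v =>
    if v ∈ T then ((r : K) : v.adicCompletion K) else 1
  have hf : ∀ v, Valued.v (f v) = 1 := by
    intro v
    by_cases hv : v ∈ T
    · simp only [f, if_pos hv]
      exact valued_coe_eq_one v (hrv v (hT v hv))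
    · simp only [f, if_neg hv, map_one]
  refine ⟨mkIdele 1 f hf, ?_, ?_, fun v hv => ?_, fun v hv => ?_⟩
  · rw [mem_finiteUnitIdeles]
    exact ⟨infHom_mkIdele _ _ _, fun v => by rw [finComp_mkIdele]; exact hf v⟩
  · intro v n hn
    rw [finComp_mkIdele]
    by_cases hv : v ∈ T
    · simp only [f, if_pos hv, sub_self, map_zero]
      exact zero_le
    · simp only [f, if_neg hv]
      have : (1 : v.adicCompletion K) - ((r : K) : v.adicCompletion K) =
          -(((r - 1 : 𝓞 K) : K) : v.adicCompletion K) := by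
        rw [coe_int_sub, coe_int_one]; ring
      rw [this, Valuation.map_neg, valued_coe_le_iff]
      exact h v hv n hn
  · rw [finComp_mkIdele]; simp only [f, if_neg hv]
  · rw [finComp_mkIdele]; simp only [f, if_pos hv]

end

section

variable {K : Type*} [Field K] [NumberField K] {𝔞 : Ideal (𝓞 K)}

/-! ### The conductor -/

theorem localUnits_subset_finiteUnitIdeles (v : HeightOneSpectrum (𝓞 K)) (n : ℕ) :
    localUnits v n ⊆ finiteUnitIdeles K := by
  rintro x ⟨h1, h2, h3, -⟩
  refine ⟨h1, fun w => ?_⟩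
  by_cases hw : w = v
  · rw [hw, h3]
  · rw [h2 w hw, map_one]

theorem localUnits_antitone (v : HeightOneSpectrum (𝓞 K)) {m n : ℕ} (h : m ≤ n) :
    localUnits v n ⊆ localUnits v m := by
  rintro x ⟨h1, h2, h3, h4⟩
  refine ⟨h1, h2, h3, h4.trans ?_⟩
  rw [WithZero.exp_le_exp]
  omega

/-- If 𝔟 ≤ 𝔭, every lift of a unit is a unit modulo 𝔟𝔭. Otherwise 𝔟 and 𝔭 are coprime and a lift
congruent to 1 modulo 𝔭 is chosen. -/
theorem units_map_factor_surjective_of_eq_mul {R : Type*} [CommRing R] {𝔞 𝔟 𝔭 : Ideal R}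
    (h𝔭 : 𝔭.IsMaximal) (h : 𝔞 = 𝔟 * 𝔭)
    (hle : 𝔞 ≤ 𝔟) : Function.Surjective (Units.map (Ideal.Quotient.factor hle).toMonoidHom) := by
  intro b
  obtain ⟨r, hr⟩ := Ideal.Quotient.mk_surjective (b : R ⧸ 𝔟)
  obtain ⟨t, ht⟩ := Ideal.Quotient.mk_surjective ((b⁻¹ : (R ⧸ 𝔟)ˣ) : R ⧸ 𝔟)
  have hrt : r * t - 1 ∈ 𝔟 := by
    rw [← Ideal.Quotient.eq, map_mul, hr, ht, map_one, Units.mul_inv]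
  have lift : ∀ s : R, s - r ∈ 𝔟 → (∃ t' : R, s * t' - 1 ∈ 𝔞) →
      ∃ a, Units.map (Ideal.Quotient.factor hle).toMonoidHom a = b := by
    rintro s hs ⟨t', ht'⟩
    have h1 : Ideal.Quotient.mk 𝔞 s * Ideal.Quotient.mk 𝔞 t' = 1 := by
      rw [← map_mul, ← map_one (Ideal.Quotient.mk 𝔞), Ideal.Quotient.eq]; exact ht'
    refine ⟨⟨_, _, h1, by rw [mul_comm, h1]⟩, Units.ext ?_⟩
    change Ideal.Quotient.mk 𝔟 s = b
    rw [← hr, Ideal.Quotient.eq]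
    exact hs
  have comb : ∀ s t₁ t₂ : R, s * t₁ - 1 ∈ 𝔟 → s * t₂ - 1 ∈ 𝔭 → ∃ t' : R, s * t' - 1 ∈ 𝔞 := by
    intro s t₁ t₂ h1 h2
    -- This inverse satisfies 1 − s t' = (1 − s t₁)(1 − s t₂).
    refine ⟨t₁ + t₂ - s * t₁ * t₂, ?_⟩
    rw [h]
    have := neg_mem (Ideal.mul_mem_mul h1 h2)
    convert this using 1
    ring
  by_cases hb : 𝔟 ≤ 𝔭
  · exact lift r (by simp) (comb r t t hrt (hb hrt))
  · have hcop : IsCoprime 𝔟 𝔭 := by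
      rw [Ideal.isCoprime_iff_sup_eq, sup_comm]
      exact h𝔭.out.2 _ (lt_of_le_of_ne le_sup_left fun h => hb (h ▸ le_sup_right))
    obtain ⟨i, hi, j, hj, hij⟩ := Ideal.isCoprime_iff_exists.1 hcop
    refine lift (r * j + i) ?_ (comb _ t 1 ?_ ?_)
    · have : r * j + i - r = i * (1 - r) := by linear_combination r * hij
      rw [this]; exact Ideal.mul_mem_right _ _ hi
    · have : (r * j + i) * t - 1 = (r * t - 1) + i * (t - r * t) := by
        linear_combination r * t * hij
      rw [this]; exact add_mem hrt (Ideal.mul_mem_right _ _ hi)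
    · have : (r * j + i) * 1 - 1 = j * (r - 1) := by linear_combination hij
      rw [this]; exact Ideal.mul_mem_right _ _ hj

/-- With 𝔞 = 𝔟 v, a class that is 1 modulo 𝔟 is represented by an idele supported at v and congruent
to 1 modulo v^(n−1). There χ is trivial, so ξ factors through (𝓞 K / 𝔟)^×; surjectivity of the
reduction of units lets the factor be defined on the whole group. -/
theorem not_isPrimitive_of_forall_localUnits (h𝔞 : 𝔞 ≠ ⊥) {ξ : (𝓞 K ⧸ 𝔞)ˣ →* Circle}
    {χ : IdeleCharacter K} (hχ : Lifts χ ξ) (v : HeightOneSpectrum (𝓞 K)) {m : ℕ}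
    (hm : m < multiplicity v.asIdeal 𝔞) (h : ∀ x ∈ localUnits v m, χ x = 1) : ¬ IsPrimitive ξ := by
  intro hprim
  set n := multiplicity v.asIdeal 𝔞 with hn
  have hv : v.asIdeal ∣ 𝔞 := by
    have := (pow_dvd_iff_le_multiplicity h𝔞 v 1).2 (by omega)
    rwa [pow_one] at this
  obtain ⟨𝔟, h𝔟⟩ := hv
  rw [mul_comm] at h𝔟
  have hle : 𝔞 ≤ 𝔟 := h𝔟 ▸ Ideal.mul_le_left
  have hlt : 𝔞 < 𝔟 := by
    refine lt_of_le_of_ne hle fun he => v.isPrime.ne_top ?_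
    have h𝔟0 : 𝔟 ≠ 0 := fun h0 => h𝔞 (by rw [he, h0]; rfl)
    have : 𝔟 * v.asIdeal = 𝔟 * ⊤ := by rw [← h𝔟, Ideal.mul_top, he]
    exact mul_left_cancel₀ h𝔟0 this
  have hsurj := units_map_factor_surjective_of_eq_mul v.isMaximal h𝔟 hlt.le
  refine hprim 𝔟 hlt ?_
  have hker : (Units.map (Ideal.Quotient.factor hlt.le).toMonoidHom).ker ≤ ξ.ker := by
    intro a ha
    obtain ⟨r, hr⟩ := Ideal.Quotient.mk_surjective (a : 𝓞 K ⧸ 𝔞)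
    have hr1 : r - 1 ∈ 𝔟 := by
      rw [← Ideal.Quotient.eq, map_one]
      have h1 := congrArg Units.val (MonoidHom.mem_ker.1 ha)
      rw [Units.coe_map, ← hr] at h1
      exact h1
    obtain ⟨x, hx, hxr, hx1, hxv⟩ := exists_finiteUnitIdeles_congrMod (𝔞 := 𝔞) r
      (by rw [hr]; exact a.isUnit) {v} (by rintro w rfl; exact h𝔟 ▸ dvd_mul_left _ _) (by
        intro w hw k hk
        have hwv : w.asIdeal ≠ v.asIdeal := fun he => hw (HeightOneSpectrum.ext he)
        have hcop : IsCoprime (w.asIdeal ^ k) v.asIdeal := by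
          apply IsCoprime.pow_left
          rw [Ideal.isCoprime_iff_sup_eq]
          exact w.isMaximal.coprime_of_ne v.isMaximal hwv
        rw [h𝔟] at hk
        exact Ideal.dvd_iff_le.1 (hcop.dvd_of_dvd_mul_right hk) hr1)
    rw [MonoidHom.mem_ker, ← hχ x hx r a hr.symm hxr]
    apply h
    refine localUnits_antitone v (show m ≤ n - 1 by omega) ⟨hx.1, fun w hw => hx1 w hw, hx.2 v, ?_⟩
    rw [hxv v rfl, ← coe_int_one, ← coe_int_sub, valued_coe_le_iff]
    refine Ideal.dvd_iff_le.1 ?_ hr1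
    have h1 : v.asIdeal ^ n ∣ 𝔟 * v.asIdeal := by
      rw [← h𝔟, pow_dvd_iff_le_multiplicity h𝔞]
    have h2 : v.asIdeal ^ n = v.asIdeal ^ (n - 1) * v.asIdeal := by
      rw [← pow_succ]; congr 1; omega
    rw [h2] at h1
    exact (mul_dvd_mul_iff_right v.ne_bot).1 h1
  refine ⟨(QuotientGroup.lift _ ξ hker).comp
    (QuotientGroup.quotientKerEquivOfSurjective _ hsurj).symm.toMonoidHom, ?_⟩
  ext a
  simp only [MonoidHom.comp_apply]
  have : (QuotientGroup.quotientKerEquivOfSurjective _ hsurj).symm.toMonoidHom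
      (Units.map (Ideal.Quotient.factor hlt.le).toMonoidHom a) = (a : _ ⧸ _) := by
    change (QuotientGroup.quotientKerEquivOfSurjective _ hsurj).symm _ = _
    rw [MulEquiv.symm_apply_eq]
    rfl
  rw [this]
  rfl

theorem conductor_eq_of_lifts (h𝔞 : 𝔞 ≠ ⊥) {ξ : (𝓞 K ⧸ 𝔞)ˣ →* Circle} (hprim : IsPrimitive ξ)
    {χ : IdeleCharacter K} (hχ : Lifts χ ξ) : conductor χ = 𝔞 := by
  rw [conductor, ← Ideal.finprod_heightOneSpectrum_pow_multiplicity h𝔞]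
  congr 1
  ext1 v
  congr 1
  have hmem : multiplicity v.asIdeal 𝔞 ∈ {n : ℕ | ∀ x ∈ localUnits v n, χ x = 1} := by
    intro x hx
    have hx1 : CongrMod 𝔞 x 1 := by
      rw [congrMod_iff h𝔞]
      intro w
      by_cases hw : w = v
      · rw [hw, coe_int_one]; exact hx.2.2.2
      · rw [hx.2.1 w hw, coe_int_one, sub_self, map_zero]; exact zero_le
    rw [hχ x (localUnits_subset_finiteUnitIdeles v _ hx) 1 1 (by simp) hx1, map_one]
  refine le_antisymm (Nat.sInf_le hmem) ?_
  by_contra! hlt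
  exact not_isPrimitive_of_forall_localUnits h𝔞 hχ v hlt (Nat.sInf_mem ⟨_, hmem⟩) hprim

/-! ### Continuity -/

/-- The hypothesis makes χ trivial on a neighbourhood of 1: only finitely many congruences are
imposed, and infinite components close to 1 are squares. -/
theorem continuous_of_forall_congrMod (h𝔞 : 𝔞 ≠ ⊥) (χ : Ideles K →* Circle)
    (h : ∀ x ∈ unitIdeles K, CongrMod 𝔞 x 1 → (∃ z, infHom x = z ^ 2) → χ x = 1) :
    Continuous χ := by
  have hfin : ∀ y : FiniteAdeleRing (𝓞 K) K, (∀ v, Valued.v (y v) ≤ 1) →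
      ∀ᶠ z in nhds y, ∀ v, Valued.v (z v) ≤ 1 := by
    intro y hy
    have ho : IsOpen {z : FiniteAdeleRing (𝓞 K) K | ∀ v, Valued.v (z v) ≤ 1} :=
      RestrictedProduct.isOpen_forall_mem fun v => Valued.isOpen_valuationSubring _
    exact ho.mem_nhds hy
  have hloc : ∀ v : HeightOneSpectrum (𝓞 K), ∀ᶠ z in nhds (1 : FiniteAdeleRing (𝓞 K) K),
      Valued.v (z v - 1) ≤ WithZero.exp (-(multiplicity v.asIdeal 𝔞 : ℤ)) := by
    intro v
    have hc : Continuous fun z : FiniteAdeleRing (𝓞 K) K => z v - 1 :=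
      (RestrictedProduct.continuous_eval v).sub continuous_const
    refine ((isOpen_valued_le v _).preimage hc).mem_nhds ?_
    change Valued.v ((1 : v.adicCompletion K) - 1) ≤ _
    rw [sub_self, map_zero]; exact zero_le
  have hinf : ∀ v : InfinitePlace K, ∀ᶠ z in nhds (1 : InfiniteAdeleRing K), ‖z v - 1‖ < 1 := by
    intro v
    have hc : Continuous fun z : InfiniteAdeleRing K => ‖z v - 1‖ :=
      ((continuous_apply v).sub continuous_const).norm
    refine (isOpen_Iio.preimage hc).mem_nhds ?_
    change ‖(1 : v.Completion) - 1‖ < 1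
    simp
  have c1 : Continuous fun x : Ideles K => (x : AdeleRing (𝓞 K) K).1 :=
    continuous_fst.comp Units.continuous_val
  have c2 : Continuous fun x : Ideles K => (x : AdeleRing (𝓞 K) K).2 :=
    continuous_snd.comp Units.continuous_val
  have c3 : Continuous fun x : Ideles K => ((x⁻¹ : Ideles K) : AdeleRing (𝓞 K) K).2 :=
    c2.comp continuous_inv
  have e1 : ∀ᶠ x : Ideles K in nhds 1, ∀ v, Valued.v (finComp x v) ≤ 1 :=
    (c2.tendsto 1).eventually (hfin 1 fun v => (map_one _).le)
  -- Integrality of both x and x⁻¹ is what makes every finite component a unit.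
  have e2 : ∀ᶠ x : Ideles K in nhds 1, ∀ v, Valued.v (finComp x⁻¹ v) ≤ 1 :=
    (c3.tendsto 1).eventually (hfin _ fun v => by rw [inv_one]; exact (map_one _).le)
  have e3 : ∀ᶠ x : Ideles K in nhds 1, ∀ v ∈ {v : HeightOneSpectrum (𝓞 K) | v.asIdeal ∣ 𝔞},
      Valued.v (finComp x v - 1) ≤ WithZero.exp (-(multiplicity v.asIdeal 𝔞 : ℤ)) := by
    rw [Filter.eventually_all_finite (finite_dvd h𝔞)]
    exact fun v _ => (c2.tendsto 1).eventually (hloc v)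
  have e4 : ∀ᶠ x : Ideles K in nhds 1, ∀ v : InfinitePlace K, ‖infPart x v - 1‖ < 1 := by
    rw [Filter.eventually_all]
    exact fun v => (c1.tendsto 1).eventually (hinf v)
  have ev : ∀ᶠ x : Ideles K in nhds 1, χ x = 1 := by
    filter_upwards [e1, e2, e3, e4] with x h1 h2 h3 h4
    apply h
    · intro v
      have h5 := congrArg Valued.v (finComp_mul_inv x v)
      rw [map_mul, map_one] at h5
      exact eq_one_of_one_le_mul_left (h1 v) (h2 v) h5.ge
    · rw [congrMod_iff h𝔞]
      intro v
      rw [coe_int_one]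
      by_cases hv : v.asIdeal ∣ 𝔞
      · exact h3 v hv
      · rw [multiplicity_eq_zero.2 hv]
        simpa using Valuation.map_sub_le _ (h1 v) (map_one (Valued.v (R := v.adicCompletion K))).le
    · obtain ⟨z, hz⟩ := exists_pow_eq (infHom x) two_ne_zero fun v =>
        exists_pow_eq_of_norm_sub_one_lt _ (h4 v) two_ne_zero
      exact ⟨z, hz.symm⟩
  apply continuous_of_continuousAt_one
  rw [ContinuousAt, map_one]
  exact tendsto_const_nhds.congr' (ev.mono fun x hx => hx.symm)

end

/-! ### Construction and uniqueness of the idele class character. -/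

section

variable {K : Type*} [Field K] [NumberField K] {𝔞 : Ideal (𝓞 K)}

/-- Reduction of global units modulo `𝔞`. -/
abbrev unitRed (𝔞 : Ideal (𝓞 K)) : (𝓞 K)ˣ →* (𝓞 K ⧸ 𝔞)ˣ :=
  Units.map (Ideal.Quotient.mk 𝔞).toMonoidHom

/-- The embedding of the global units in the infinite ideles, as a homomorphism. -/
def unitInfHom : (𝓞 K)ˣ →* (InfiniteAdeleRing K)ˣ :=
  (Units.map (algebraMap K (InfiniteAdeleRing K)).toMonoidHom).comp
    (Units.map (algebraMap (𝓞 K) K).toMonoidHom)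

/-- The principal idele of a unit. -/
def unitPrincipal (u : (𝓞 K)ˣ) : Ideles K :=
  principal (Units.map (algebraMap (𝓞 K) K).toMonoidHom u)

theorem infHom_unitPrincipal (u : (𝓞 K)ˣ) : infHom (unitPrincipal u) = unitInf u := rfl

theorem unitPrincipal_mem (u : (𝓞 K)ˣ) : unitPrincipal u ∈ unitIdeles K := by
  intro v
  refine valued_coe_eq_one v fun h => v.isPrime.ne_top (Ideal.eq_top_of_isUnit_mem _ h u.isUnit)

theorem congrMod_unitPrincipal (u : (𝓞 K)ˣ) : CongrMod 𝔞 (unitPrincipal u) (u : 𝓞 K) := by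
  intro v n _
  have : finComp (unitPrincipal u) v - (((u : 𝓞 K) : K) : v.adicCompletion K) = 0 := sub_self _
  rw [this, map_zero]
  exact zero_le

theorem residue_unitPrincipal (h𝔞 : 𝔞 ≠ ⊥) (u : (𝓞 K)ˣ) :
    residue h𝔞 ⟨unitPrincipal u, unitPrincipal_mem u⟩ = unitRed 𝔞 u :=
  Units.ext (residue_eq h𝔞 _ (congrMod_unitPrincipal u))

theorem eq_unitPrincipal_of_mem {a : Kˣ} (ha : principal a ∈ unitIdeles K) :
    ∃ u : (𝓞 K)ˣ, principal a = unitPrincipal u := by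
  obtain ⟨u, hu⟩ := exists_unit_of_principal_mem a ha
  exact ⟨u, by rw [unitPrincipal]; congr 1; exact Units.ext hu.symm⟩

/-- The character of the infinite ideles which is trivial on squares and inverse to `ξ` on
global units. -/
theorem exists_infinite_character {K : Type*} [Field K] {𝔞 : Ideal (𝓞 K)}
    {ξ : (𝓞 K ⧸ 𝔞)ˣ →* Circle} (h₁ : ∀ y : (InfiniteAdeleRing K)ˣ, ∃ u z, y = unitInf u * z ^ 2)
    (h₂ : ∀ (u : (𝓞 K)ˣ) (z : (InfiniteAdeleRing K)ˣ), unitInf u = z ^ 2 → ξ (unitRed 𝔞 u) = 1) :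
    ∃ ψ : (InfiniteAdeleRing K)ˣ →* Circle, (∀ z, ψ (z ^ 2) = 1) ∧
      ∀ u, ψ (unitInf u) = (ξ (unitRed 𝔞 u))⁻¹ := by
  obtain ⟨ψ, hψ⟩ := exists_monoidHom_of_pow_eq (powMonoidHom 2).range (unitInfHom (K := K))
    (ξ.comp (unitRed 𝔞))⁻¹ (by
      rintro u ⟨z, hz⟩
      exact inv_eq_one.2 (h₂ u z hz.symm)) 1 (by
      intro y
      obtain ⟨u, z, h⟩ := h₁ y
      exact ⟨z ^ 2, ⟨z, rfl⟩, u, by rw [pow_one, h, mul_comm]; rfl⟩)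
  refine ⟨ψ, fun z => ?_, fun u => ?_⟩
  · rw [hψ (z ^ 2) (z ^ 2) ⟨z, rfl⟩ 1 (by simp), map_one]
  · exact hψ _ 1 (one_mem _) u (by rw [pow_one, one_mul]; rfl)

theorem pow_eq_self_of_mod {M : Type*} [Monoid M] {x : M} {n N : ℕ} (hx : x ^ n = 1)
    (hN : N % n = 1) : x ^ N = x := by
  rw [← Nat.div_add_mod N n, hN, pow_add, pow_mul, hx, one_pow, one_mul, pow_one]

theorem exists_mul_pow_classNumber_eq (x : Ideles K) (m : ℕ) :
    ∃ a : Kˣ, ∃ w : unitIdeles K, x ^ (classNumber K * m) = principal a * (w : Ideles K) := by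
  obtain ⟨a, w, hw, h⟩ := exists_pow_classNumber_eq x
  exact ⟨a ^ m, ⟨w ^ m, pow_mem hw m⟩, by rw [pow_mul, h, mul_pow, map_pow]⟩

/-- Oddness of the class number enters here: raising to the power h is invertible on values of
2-power order. -/
theorem exists_mul_mod_eq_one (hodd : Odd (classNumber K)) {e : ℕ} (he : 1 ≤ e) :
    ∃ m, classNumber K * m % 2 ^ e = 1 := by
  have hcop : Nat.Coprime (classNumber K) (2 ^ e) := (Nat.coprime_two_right.2 hodd).pow_right e
  obtain ⟨m, -, hm⟩ := Nat.exists_mul_mod_eq_one_of_coprime hcop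
    (Nat.one_lt_pow (by omega) (by norm_num))
  exact ⟨m, hm⟩

theorem pow_apply (χ : IdeleCharacter K) (n : ℕ) (x : Ideles K) : (χ ^ n) x = χ x ^ n := by
  induction n with
  | zero => rw [pow_zero, pow_zero]; rfl
  | succ n ih => rw [pow_succ, pow_succ, ← ih]; rfl

theorem orderOf_dvd_of_lifts {ξ : (𝓞 K ⧸ 𝔞)ˣ →* Circle} {χ : IdeleCharacter K} (hχ : Lifts χ ξ) :
    orderOf ξ ∣ orderOf χ := by
  rw [orderOf_dvd_iff_pow_eq_one]
  ext a
  obtain ⟨r, hr⟩ := Ideal.Quotient.mk_surjective (a : 𝓞 K ⧸ 𝔞)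
  obtain ⟨x, hx, hxr, -⟩ := exists_finiteUnitIdeles_congrMod (𝔞 := 𝔞) r (by rw [hr]; exact a.isUnit)
    {v | v.asIdeal ∣ 𝔞} (fun v hv => hv) (by
      intro v hv n hn
      have : n = 0 := by
        by_contra h0
        exact hv ((dvd_pow_self _ h0).trans hn)
      rw [this, pow_zero, Ideal.one_eq_top]
      trivial)
  have h1 := pow_apply χ (orderOf χ) x
  rw [pow_orderOf_eq_one, hχ x hx r a hr.symm hxr] at h1
  rw [MonoidHom.pow_apply, ← h1]
  rfl

theorem exists_character (h𝔞 : 𝔞 ≠ ⊥) {ξ : (𝓞 K ⧸ 𝔞)ˣ →* Circle} (hprim : IsPrimitive ξ) {e : ℕ}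
    (he : 1 ≤ e) (hord : orderOf ξ = 2 ^ e) (hodd : Odd (classNumber K))
    (h₁ : ∀ y : (InfiniteAdeleRing K)ˣ, ∃ u z, y = unitInf u * z ^ 2)
    (h₂ : ∀ (u : (𝓞 K)ˣ) (z : (InfiniteAdeleRing K)ˣ), unitInf u = z ^ 2 → ξ (unitRed 𝔞 u) = 1) :
    ∃ χ : IdeleCharacter K, IsIdeleClassCharacter χ ∧ conductor χ = 𝔞 ∧
        orderOf χ = 2 ^ e ∧ Lifts χ ξ := by
  obtain ⟨ψ, hψ2, hψ⟩ := exists_infinite_character h₁ h₂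
  obtain ⟨m, hm⟩ := exists_mul_mod_eq_one hodd he
  have hξn : ∀ a, ξ a ^ 2 ^ e = 1 := fun a => by
    rw [← MonoidHom.pow_apply, ← hord, pow_orderOf_eq_one]; rfl
  have hψn : ∀ y, ψ y ^ 2 ^ e = 1 := fun y => by
    have h2 : 2 ^ e = 2 * 2 ^ (e - 1) := by rw [← pow_succ']; congr 1; omega
    rw [h2, pow_mul, ← map_pow, hψ2, one_pow]
  let θ : unitIdeles K →* Circle :=
    ξ.comp (residue h𝔞) * ψ.comp (infHom.comp (unitIdeles K).subtype)
  have hθ : ∀ w, θ w = ξ (residue h𝔞 w) * ψ (infHom (w : Ideles K)) := fun _ => rfl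
  have hθn : ∀ w, θ w ^ 2 ^ e = 1 := fun w => by rw [hθ, mul_pow, hξn, hψn, one_mul]
  -- A principal idele that is a unit idele comes from a global unit, on which the factors ξ and ψ =
  -- ξ⁻¹ cancel.
  obtain ⟨χ₀, hχ₀⟩ := exists_monoidHom_of_pow_eq (principal (K := K)).range (unitIdeles K).subtype θ
    (by
      rintro ⟨w, hw⟩ ⟨a, rfl : principal a = w⟩
      obtain ⟨u, hu⟩ := eq_unitPrincipal_of_mem hw
      have : (⟨principal a, hw⟩ : unitIdeles K) = ⟨unitPrincipal u, unitPrincipal_mem u⟩ :=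
        Subtype.ext hu
      rw [this, hθ, residue_unitPrincipal, infHom_unitPrincipal, hψ, mul_inv_cancel])
    (classNumber K * m) (by
      intro x
      obtain ⟨a, w, h⟩ := exists_mul_pow_classNumber_eq x m
      exact ⟨_, ⟨a, rfl⟩, w, h⟩)
  have hprin : ∀ a, χ₀ (principal a) = 1 := fun a => by
    rw [hχ₀ _ (principal a ^ (classNumber K * m))
      (pow_mem (MonoidHom.mem_range.2 ⟨a, rfl⟩) _) 1 (by simp), map_one]
  have hunit : ∀ w : unitIdeles K, χ₀ w = θ w := fun w => by
    rw [hχ₀ w 1 (one_mem _) (w ^ (classNumber K * m)) (by simp), map_pow,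
      pow_eq_self_of_mod (hθn w) hm]
  have hn : ∀ x, χ₀ x ^ 2 ^ e = 1 := fun x => by
    obtain ⟨a, w, h⟩ := exists_mul_pow_classNumber_eq x m
    rw [hχ₀ x _ ⟨a, rfl⟩ w h, hθn]
  have hcont : Continuous χ₀ := by
    apply continuous_of_forall_congrMod h𝔞
    rintro x hx h1 ⟨z, hz⟩
    have hr : residue h𝔞 ⟨x, hx⟩ = 1 := by
      apply Units.ext
      rw [residue_eq h𝔞 ⟨x, hx⟩ h1, map_one, Units.val_one]
    rw [hunit ⟨x, hx⟩, hθ, hr, hz, hψ2, map_one, one_mul]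
  let χ : IdeleCharacter K := ⟨χ₀, hcont⟩
  have hχ : ∀ x, χ x = χ₀ x := fun _ => rfl
  have hlift : Lifts χ ξ := by
    intro x hx r a ha hxr
    obtain ⟨hx1, hx2⟩ := mem_finiteUnitIdeles.1 hx
    have hr : residue h𝔞 ⟨x, hx2⟩ = a := by
      apply Units.ext
      rw [residue_eq h𝔞 ⟨x, hx2⟩ hxr, ha]
    rw [hχ, hunit ⟨x, hx2⟩, hθ, hr, hx1, map_one, mul_one]
  refine ⟨χ, hprin, conductor_eq_of_lifts h𝔞 hprim hlift, ?_, hlift⟩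
  apply Nat.dvd_antisymm
  · apply orderOf_dvd_of_pow_eq_one
    ext x
    rw [pow_apply, hχ, hn]
    rfl
  · rw [← hord]
    exact orderOf_dvd_of_lifts hlift

/-- Lifting ξ fixes the values on finite units. At infinity 2^e-th powers are killed, and the value
at a global unit u is forced by triviality on the principal idele of u. Then x^(h m) determines the
value at x. -/
theorem character_unique (h𝔞 : 𝔞 ≠ ⊥) {ξ : (𝓞 K ⧸ 𝔞)ˣ →* Circle} {e : ℕ} (he : 1 ≤ e)
    (hodd : Odd (classNumber K))
    (h₁ : ∀ y : (InfiniteAdeleRing K)ˣ, ∃ u z, y = unitInf u * z ^ 2 ^ e)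
    {χ χ' : IdeleCharacter K} (hχ : IsIdeleClassCharacter χ) (hχ' : IsIdeleClassCharacter χ')
    (hn : orderOf χ = 2 ^ e) (hn' : orderOf χ' = 2 ^ e) (hl : Lifts χ ξ) (hl' : Lifts χ' ξ) :
    χ = χ' := by
  obtain ⟨m, hm⟩ := exists_mul_mod_eq_one hodd he
  have hpow : ∀ φ : IdeleCharacter K, orderOf φ = 2 ^ e → ∀ x, φ x ^ 2 ^ e = 1 := fun φ hφ x => by
    rw [← pow_apply, ← hφ, pow_orderOf_eq_one]; rfl
  have hfin : ∀ x ∈ finiteUnitIdeles K, χ x = χ' x := by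
    intro x hx
    have hx2 := (mem_finiteUnitIdeles.1 hx).2
    obtain ⟨r, hr⟩ := exists_congrMod h𝔞 hx2
    have ha := residue_eq h𝔞 ⟨x, hx2⟩ hr
    rw [hl x hx r _ ha hr, hl' x hx r _ ha hr]
  let ι : (InfiniteAdeleRing K)ˣ → Ideles K := fun y => mkIdele y (fun _ => 1) (fun _ => map_one _)
  have hι : ∀ y z, ι (y * z) = ι y * ι z := fun y z => by
    apply ideles_ext
    · rw [map_mul]; simp only [ι, infHom_mkIdele]
    · intro v; rw [finComp_mul]; simp only [ι, finComp_mkIdele, mul_one]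
  let ιh : (InfiniteAdeleRing K)ˣ →* Ideles K := MonoidHom.mk' ι hι
  have hinf : ∀ y, χ (ιh y) = χ' (ιh y) := by
    intro y
    obtain ⟨u, z, rfl⟩ := h₁ y
    have hu : χ (ιh (unitInf u)) = χ' (ιh (unitInf u)) := by
      obtain ⟨w, hw, hw'⟩ := exists_eq_mkIdele_mul (unitPrincipal u) (unitPrincipal_mem u)
      rw [infHom_unitPrincipal] at hw'
      change unitPrincipal u = ιh (unitInf u) * w at hw'
      have h1 : χ (unitPrincipal u) = 1 := hχ _
      have h2 : χ' (unitPrincipal u) = 1 := hχ' _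
      rw [hw', map_mul] at h1 h2
      rw [eq_inv_of_mul_eq_one_left h1, eq_inv_of_mul_eq_one_left h2, hfin w hw]
    rw [map_mul, map_mul, map_mul, hu, map_pow, map_pow, map_pow, hpow χ hn, hpow χ' hn']
  have hunit : ∀ x ∈ unitIdeles K, χ x = χ' x := by
    intro x hx
    obtain ⟨w, hw, hw'⟩ := exists_eq_mkIdele_mul x hx
    change x = ιh (infHom x) * w at hw'
    rw [hw', map_mul, map_mul, hinf, hfin w hw]
  ext x
  obtain ⟨a, w, h⟩ := exists_mul_pow_classNumber_eq x m
  rw [← pow_eq_self_of_mod (hpow χ hn x) hm, ← pow_eq_self_of_mod (hpow χ' hn' x) hm, ← map_pow,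
    ← map_pow, h, map_mul, map_mul, hχ a, hχ' a, hunit w w.2]

theorem existsUnique_character (h𝔞 : 𝔞 ≠ ⊥) {ξ : (𝓞 K ⧸ 𝔞)ˣ →* Circle} (hprim : IsPrimitive ξ)
    {e : ℕ} (he : 1 ≤ e) (hord : orderOf ξ = 2 ^ e) (hodd : Odd (classNumber K))
    (h₁ : ∀ (y : (InfiniteAdeleRing K)ˣ) (n : ℕ), n ≠ 0 → ∃ u z, y = unitInf u * z ^ n)
    (h₂ : ∀ (u : (𝓞 K)ˣ) (z : (InfiniteAdeleRing K)ˣ), unitInf u = z ^ 2 → ξ (unitRed 𝔞 u) = 1) :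
    ∃! χ : IdeleCharacter K, IsIdeleClassCharacter χ ∧ conductor χ = 𝔞 ∧
        orderOf χ = 2 ^ e ∧ Lifts χ ξ := by
  obtain ⟨χ, hχ⟩ := exists_character h𝔞 hprim he hord hodd (fun y => h₁ y 2 two_ne_zero) h₂
  exact ⟨χ, hχ, fun χ' hχ' => character_unique h𝔞 he hodd
    (fun y => h₁ y _ (pow_ne_zero _ two_ne_zero)) hχ'.1 hχ.1 hχ'.2.2.1 hχ.2.2.1 hχ'.2.2.2 hχ.2.2.2⟩

end

end QuadraticIdele

end

/-- In the second alternative, `K` being quadratic, a square root `s` of `d` in `K` generates `K`,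
so that `K = ℚ(√d)`, which is real quadratic. -/
theorem corollary3p3 (K : Type*) [Field K] [NumberField K] (hK : Module.finrank ℚ K = 2)
    (𝔞 : Ideal (𝓞 K)) (h𝔞 : 𝔞 ≠ ⊥) (ξ : (𝓞 K ⧸ 𝔞)ˣ →* Circle)
    (hprim : QuadraticIdele.IsPrimitive ξ) (e : ℕ) (he : 1 ≤ e) (hord : orderOf ξ = 2 ^ e)
    (hcase :
      (IsTotallyComplex K ∧ Odd (classNumber K) ∧
        ∀ u : (𝓞 K)ˣ, QuadraticIdele.unitValue ξ u = 1) ∨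
      ((∃ d : ℕ, d.Prime ∧ (d % 4 = 1 ∨ d = 2) ∧ ∃ s : K, s ^ 2 = (d : K)) ∧
        ∀ u : (𝓞 K)ˣ, QuadraticIdele.unitValue ξ u = 1 ∨ QuadraticIdele.unitValue ξ u = -1)) :
    ∃! χ : QuadraticIdele.IdeleCharacter K,
      QuadraticIdele.IsIdeleClassCharacter χ ∧ QuadraticIdele.conductor χ = 𝔞 ∧
        orderOf χ = 2 ^ e ∧ QuadraticIdele.Lifts χ ξ := by
  rcases hcase with ⟨hc, hodd, hξ⟩ | ⟨⟨d, hd, hd4, s, hs⟩, hξ⟩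
  · exact QuadraticIdele.existsUnique_character h𝔞 hprim he hord hodd
      (fun y _ hn => QuadraticIdele.exists_unitInf_mul_pow_of_isTotallyComplex y hn)
      (fun u _ _ => Circle.ext (hξ u))
  · obtain ⟨D⟩ := QuadraticIdele.PrimeQuadratic.nonempty hK hd hd4 hs
    refine QuadraticIdele.existsUnique_character h𝔞 hprim he hord D.odd_classNumber
      (fun y _ hn => D.exists_unitInf_mul_pow y hn) (fun u z h => ?_)
    -- A unit that is a square at infinity is a global square w², so ξ takes the value (±1)² = 1 on
    -- it.
    obtain ⟨w, rfl⟩ := D.exists_sq_of_unitInf_eq_sq u z h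
    rw [map_pow, map_pow]
    apply Circle.ext
    have h1 := hξ w
    rw [QuadraticIdele.unitValue] at h1
    rw [Circle.coe_pow]
    rcases h1 with h1 | h1 <;> rw [h1] <;> simp
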